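/- Let $\zeta\ge 0$, $\theta>0$, $\eta>0$ and let \[ f(r)=\begin{cases}\zeta r & \text{for } 0\le r\le\theta,\\ (\zeta+\eta)(r-\theta)+\zeta\theta & \text{for } r\ge\theta.\end{cases} \] Let $\mathcal U$ denote the cone of all $u\in L^2(\mathbb R)$ that are even, nonnegative and unimodal, i.e. $u(x)=u(-x)$ for almost every $x$ and $u(x)\ge u(\tilde x)\ge 0$ for almost all $0<x<\tilde x$. Let $a:\mathbb R\to\mathbb R$ be a convolution kernel that belongs to $\mathcal U\cap L^1(\mathbb R)$, satisfies $\int_{\mathbb R}a(x)\,dx=1$, and is differentiable on $(0,\infty)$ with $a'(x)<0$ for every $x>0$. Then for every $\sigma\in(\zeta,\zeta+\eta)$ the equation \[ \sigma u=a\ast f(u) \] (understood as an identity in $L^2(\mathbb R)$) has exactly one nontrivial solution $u_\sigma\neq 0$ in $\mathcal U$. -/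

import Mathlib

open MeasureTheory

/-- The bilinear function `f` with `f r = ζ r` for `0 ≤ r ≤ θ` and
`f r = (ζ + η) (r - θ) + ζ θ` for `r ≥ θ`. It is only ever evaluated at (almost everywhere)
nonnegative functions; for negative arguments the first formula is used. -/
noncomputable def bilinear (ζ θ η : ℝ) (r : ℝ) : ℝ :=
  if r ≤ θ then ζ * r else (ζ + η) * (r - θ) + ζ * θ

/-- The cone `𝒰` of all `L²` functions on the real line that are even, nonnegative and unimodal:
`u x = u (-x)` for almost all `x`, and `u x ≥ u y ≥ 0` for almost all pairs `0 < x < y`. -/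
def unimodalCone : Set (ℝ → ℝ) :=
  {u | MemLp u 2 volume ∧
    (∀ᵐ x : ℝ, u x = u (-x)) ∧
    (∀ᵐ p : ℝ × ℝ, 0 < p.1 → p.1 < p.2 → u p.2 ≤ u p.1 ∧ 0 ≤ u p.2)}

/-- The admissible convolution kernels: integrable members of the cone `𝒰` with integral one
that are strictly unimodal, `a' x < 0` for `x > 0`. -/
structure IsAdmissibleKernel (a : ℝ → ℝ) : Prop where
  mem_cone : a ∈ unimodalCone
  integrable : Integrable a volume
  integral_eq_one : ∫ x, a x = 1
  differentiableAt : ∀ x : ℝ, 0 < x → DifferentiableAt ℝ a x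
  deriv_neg : ∀ x : ℝ, 0 < x → deriv a x < 0

/-- `u` solves `σ u = a ∗ f(u)` (as an identity in `L²`, that is, almost everywhere), where
`(a ∗ g)(x) = ∫ a(t) g(x - t) dt` is the convolution on the real line and `f` is the bilinear
function with parameters `ζ`, `θ`, `η`. -/
def SolvesEigenproblem (a : ℝ → ℝ) (ζ θ η σ : ℝ) (u : ℝ → ℝ) : Prop :=
  ∀ᵐ x : ℝ, σ * u x =
    convolution a (fun y => bilinear ζ θ η (u y)) (ContinuousLinearMap.mul ℝ ℝ) volume x

/-! Write f(t) = ζ t + η (t − θ)₊, let A be convolution with a, and put c = η/σ, r = ζ/σ. The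
equation becomes u = A(c w + r u) with w = (u − θ)₊. Since r < 1, a Neumann series turns this into u
= S w with S = c A (1 − r A)⁻¹ (`solver`). The operator S commutes with translations, is selfadjoint
and preserves positivity. It also preserves the cone of odd functions that are nonnegative on the
half-line (`oddCone`), because a(x − y) > a(x + y) for x, y > 0 with x ≠ y.

For a unimodal solution, w vanishes outside some interval (−ξ, ξ) with u(ξ) = θ. Differentiation
then makes the problem linear: V = −u' satisfies V = S(V restricted to (−ξ, ξ)). Hence V on (0, ξ)
is a fixed point of a compact, selfadjoint, positivity preserving operator T_ξ (`truncated`).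

Existence: ‖T_ξ‖ is continuous in ξ and vanishes at ξ = 0. It exceeds 1 for large ξ, because S acts
on wide boxes almost as multiplication by c/(1 − r), which is greater than 1 as σ < ζ + η. Where the
norm equals 1 there is a nonnegative fixed point (`exists_nonneg_fixed`). Its primitive, scaled so
that the level at the edge is θ, produces u.

Uniqueness: testing the equations of two solutions against each other gives ∫ V₁ V₂ = 0 over the
interval between the two edges. Since V₁ and V₂ are positive there, the edges agree
(`Profile.ξ_le`). Irreducibility of T_ξ makes V₁ and V₂ proportional on (0, ξ)
(`exists_eq_smul_of_fixed`), and the condition u(ξ) = θ fixes the factor. Weak differentiability of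
a given solution has to be proved first (`exists_profile_of_rep`). It follows because S maps L¹ into
L² and the central differences of a bounded unimodal w are O(s) in L¹. -/

open Filter Topology RealInnerProductSpace

/-- The Hilbert space of square integrable functions on the real line. -/
abbrev L2 : Type := Lp ℝ 2 (volume : Measure ℝ)

/-! ### Translations, reflection, cut-offs and averages on L². -/

namespace L2

/-- Translation of a square integrable function, `(shift t g) x = g (x - t)`. -/
noncomputable def shift (t : ℝ) : L2 →ₗᵢ[ℝ] L2 :=
  Lp.compMeasurePreservingₗᵢ ℝ (fun x => x - t) (measurePreserving_sub_right volume t)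

/-- Reflection of a square integrable function, `(reflect g) x = g (-x)`. -/
noncomputable def reflect : L2 →ₗᵢ[ℝ] L2 :=
  Lp.compMeasurePreservingₗᵢ ℝ (fun x => -x) (Measure.measurePreserving_neg volume)

lemma coeFn_shift (t : ℝ) (g : L2) : shift t g =ᵐ[volume] fun x => g (x - t) :=
  Lp.coeFn_compMeasurePreserving g (measurePreserving_sub_right volume t)

lemma coeFn_reflect (g : L2) : reflect g =ᵐ[volume] fun x => g (-x) :=
  Lp.coeFn_compMeasurePreserving g (Measure.measurePreserving_neg volume)

lemma ae_sub {p : ℝ → Prop} (h : ∀ᵐ x, p x) (t : ℝ) : ∀ᵐ x : ℝ, p (x - t) :=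
  (measurePreserving_sub_right volume t).quasiMeasurePreserving.ae h

lemma ae_neg {p : ℝ → Prop} (h : ∀ᵐ x, p x) : ∀ᵐ x : ℝ, p (-x) :=
  (Measure.measurePreserving_neg volume).quasiMeasurePreserving.ae h

lemma ae_const_sub {p : ℝ → Prop} (h : ∀ᵐ x, p x) (t : ℝ) : ∀ᵐ x : ℝ, p (t - x) := by
  filter_upwards [ae_neg (ae_sub h (-t))] with x hx
  convert hx using 1
  ring

lemma shift_zero (g : L2) : shift 0 g = g := by
  apply Lp.ext
  filter_upwards [coeFn_shift 0 g] with x hx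
  simpa using hx

lemma shift_shift (s t : ℝ) (g : L2) :
    shift s (shift t g) = shift (s + t) g := by
  apply Lp.ext
  filter_upwards [coeFn_shift s (shift t g), coeFn_shift (s + t) g,
    ae_sub (coeFn_shift t g) s] with x h1 h2 h3
  rw [h1, h2, h3, sub_sub]

lemma shift_comm (s t : ℝ) (g : L2) :
    shift s (shift t g) = shift t (shift s g) := by
  rw [shift_shift, shift_shift, add_comm]

lemma reflect_reflect (g : L2) : reflect (reflect g) = g := by
  apply Lp.ext
  filter_upwards [coeFn_reflect (reflect g), ae_neg (coeFn_reflect g)] with x h1 h2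
  rw [h1, h2, neg_neg]

lemma reflect_shift (t : ℝ) (g : L2) :
    reflect (shift t g) = shift (-t) (reflect g) := by
  apply Lp.ext
  filter_upwards [coeFn_reflect (shift t g), ae_neg (coeFn_shift t g),
    coeFn_shift (-t) (reflect g), ae_sub (coeFn_reflect g) (-t)] with x h1 h2 h3 h4
  rw [h1, h2, h3, h4]
  congr 1
  ring

lemma inner_eq_integral (g h : L2) : ⟪g, h⟫ = ∫ x, g x * h x := by
  rw [L2.inner_def]
  congr 1
  ext x
  simp [mul_comm]

lemma integrable_mul (g h : L2) : Integrable (fun x => g x * h x) := by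
  have := L2.integrable_inner (𝕜 := ℝ) g h
  refine this.congr (Eventually.of_forall fun x => ?_)
  simp [mul_comm]

lemma inner_shift (t : ℝ) (g h : L2) : ⟪shift t g, h⟫ = ⟪g, shift (-t) h⟫ := by
  rw [← (shift (-t)).inner_map_map (shift t g) h, shift_shift,
    neg_add_cancel, shift_zero]

lemma inner_reflect (g h : L2) : ⟪reflect g, h⟫ = ⟪g, reflect h⟫ := by
  rw [← reflect.inner_map_map (reflect g) h, reflect_reflect]

lemma continuous_shift (g : L2) : Continuous fun t => shift t g := by
  let f : ℝ → C(ℝ, ℝ) := ContinuousMap.curry ⟨fun p : ℝ × ℝ => p.2 - p.1, by fun_prop⟩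
  have hf : Continuous f := ContinuousMap.continuous _
  exact Continuous.compMeasurePreservingLp (f := fun _ : ℝ => g) (g := f) continuous_const hf
    (fun t => measurePreserving_sub_right volume t) (by norm_num)

/-- Multiplication by the indicator function of a measurable set. -/
noncomputable def cut (E : Set ℝ) (hE : MeasurableSet E) : L2 →L[ℝ] L2 :=
  LinearMap.mkContinuous
    { toFun := fun g => ((Lp.memLp g).indicator hE).toLp (E.indicator g)
      map_add' := fun g h => by
        apply Lp.ext
        filter_upwards [((Lp.memLp (g + h)).indicator hE).coeFn_toLp, Lp.coeFn_add g h,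
          ((Lp.memLp g).indicator hE).coeFn_toLp, ((Lp.memLp h).indicator hE).coeFn_toLp,
          Lp.coeFn_add (((Lp.memLp g).indicator hE).toLp (E.indicator g))
            (((Lp.memLp h).indicator hE).toLp (E.indicator h))] with x h1 h2 h3 h4 h5
        rw [h1, h5, Pi.add_apply, h3, h4]
        by_cases hx : x ∈ E
        · simp only [Set.indicator_of_mem hx]
          exact h2
        · simp [hx]
      map_smul' := fun c g => by
        apply Lp.ext
        filter_upwards [((Lp.memLp (c • g)).indicator hE).coeFn_toLp, Lp.coeFn_smul c g,
          ((Lp.memLp g).indicator hE).coeFn_toLp,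
          Lp.coeFn_smul c (((Lp.memLp g).indicator hE).toLp (E.indicator g))] with x h1 h2 h3 h4
        rw [RingHom.id_apply, h1, h4, Pi.smul_apply, h3]
        by_cases hx : x ∈ E
        · simp only [Set.indicator_of_mem hx]
          exact h2
        · simp [hx] } 1 (fun g => by
      rw [one_mul]
      apply Lp.norm_le_norm_of_ae_le
      filter_upwards [((Lp.memLp g).indicator hE).coeFn_toLp] with x hx
      change ‖(((Lp.memLp g).indicator hE).toLp (E.indicator g)) x‖ ≤ _
      rw [hx]
      exact norm_indicator_le_norm_self _ _)

lemma coeFn_cut {E : Set ℝ} (hE : MeasurableSet E) (g : L2) :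
    cut E hE g =ᵐ[volume] E.indicator g :=
  ((Lp.memLp g).indicator hE).coeFn_toLp

lemma norm_cut_le {E : Set ℝ} (hE : MeasurableSet E) (g : L2) : ‖cut E hE g‖ ≤ ‖g‖ := by
  have := (cut E hE).le_of_opNorm_le (LinearMap.mkContinuous_norm_le _ zero_le_one _) g
  simpa using this

lemma cut_cut {E F : Set ℝ} (hE : MeasurableSet E) (hF : MeasurableSet F) (g : L2) :
    cut E hE (cut F hF g) = cut (E ∩ F) (hE.inter hF) g := by
  apply Lp.ext
  filter_upwards [coeFn_cut hE (cut F hF g), coeFn_cut hF g, coeFn_cut (hE.inter hF) g]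
    with x h1 h2 h3
  rw [h1, h3, ← Set.indicator_indicator]
  by_cases hx : x ∈ E <;> simp [hx, h2]

lemma inner_cut {E : Set ℝ} (hE : MeasurableSet E) (g h : L2) :
    ⟪cut E hE g, h⟫ = ⟪g, cut E hE h⟫ := by
  rw [inner_eq_integral, inner_eq_integral]
  apply integral_congr_ae
  filter_upwards [coeFn_cut hE g, coeFn_cut hE h] with x h1 h2
  rw [h1, h2]
  by_cases hx : x ∈ E <;> simp [hx]

lemma cut_mono {E : Set ℝ} (hE : MeasurableSet E) {g h : L2} (hgh : g ≤ h) :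
    cut E hE g ≤ cut E hE h := by
  rw [← Lp.coeFn_le] at hgh ⊢
  filter_upwards [coeFn_cut hE g, coeFn_cut hE h, hgh] with x h1 h2 h3
  rw [h1, h2]
  exact Set.indicator_le_indicator h3

lemma cut_nonneg {E : Set ℝ} (hE : MeasurableSet E) {g : L2} (hg : 0 ≤ g) :
    0 ≤ cut E hE g := by
  simpa using cut_mono hE hg

lemma shift_nonneg (t : ℝ) {g : L2} (hg : 0 ≤ g) : 0 ≤ shift t g := by
  rw [← Lp.coeFn_nonneg] at hg ⊢
  filter_upwards [coeFn_shift t g, ae_sub hg t] with x h1 h2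
  rw [h1]
  exact h2

lemma inner_nonneg_of_nonneg {g h : L2} (hg : 0 ≤ g) (hh : 0 ≤ h) : 0 ≤ ⟪g, h⟫ := by
  rw [inner_eq_integral]
  rw [← Lp.coeFn_nonneg] at hg hh
  apply integral_nonneg_of_ae
  filter_upwards [hg, hh] with x h1 h2 using mul_nonneg h1 h2

/-- The primitive `r ↦ ∫_{x-r}^{x} g` as an operator in the space of square integrable
functions. -/
noncomputable def average (r : ℝ) (g : L2) : L2 := ∫ s in (0 : ℝ)..r, shift s g

lemma intervalIntegrable_shift (g : L2) (p q : ℝ) :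
    IntervalIntegrable (fun s => shift s g) volume p q :=
  (continuous_shift g).intervalIntegrable _ _

lemma map_average {B : L2 →L[ℝ] L2} (hB : ∀ t g, B (shift t g) = shift t (B g))
    (r : ℝ) (g : L2) : B (average r g) = average r (B g) := by
  unfold average
  rw [← ContinuousLinearMap.intervalIntegral_comp_comm _ (intervalIntegrable_shift g _ _)]
  simp_rw [hB]

/-- The one-sided derivative of r ↦ `average r g` at 0 is g. This is how derivatives are identified
from their increments. -/
lemma eq_zero_of_average_eq_zero {g : L2} (h : ∀ r : ℝ, 0 < r → average r g = 0) : g = 0 := by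
  have h1 : HasDerivWithinAt (fun r => average r g) (shift 0 g) (Set.Ici 0) 0 :=
    (intervalIntegral.integral_hasDerivAt_right (intervalIntegrable_shift g _ _)
      ((continuous_shift g).stronglyMeasurableAtFilter _ _)
      (continuous_shift g).continuousAt).hasDerivWithinAt
  have h2 : HasDerivWithinAt (fun r => average r g) 0 (Set.Ici 0) 0 := by
    refine (hasDerivWithinAt_const (0 : ℝ) (Set.Ici 0) (0 : L2)).congr (fun r hr => ?_) ?_
    · rcases eq_or_lt_of_le (Set.mem_Ici.1 hr) with rfl | hr
      · simp [average]
      · exact h r hr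
    · simp [average]
  rw [← shift_zero g]
  exact (uniqueDiffOn_Ici (0 : ℝ) 0 (Set.mem_Ici.2 le_rfl)).eq_deriv _ h1 h2

/-- Both sides are the mixed second increment of t ↦ ∫₀ᵗ `shift` u, which is symmetric in r and s.
-/
lemma average_shift_sub (r s : ℝ) (u : L2) :
    average r (shift s u - u) = average s (shift r u - u) := by
  have key : ∀ p q : ℝ, average p (shift q u - u)
      = (∫ t in (0 : ℝ)..(p + q), shift t u) - (∫ t in (0 : ℝ)..q, shift t u)
        - ∫ t in (0 : ℝ)..p, shift t u := by
    intro p q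
    unfold average
    simp_rw [map_sub, shift_shift]
    rw [intervalIntegral.integral_sub _ (intervalIntegrable_shift u _ _),
      intervalIntegral.integral_comp_add_right (fun t => shift t u), zero_add,
      intervalIntegral.integral_interval_sub_left (intervalIntegrable_shift u _ _)
        (intervalIntegrable_shift u _ _)]
    exact ((continuous_shift u).comp (continuous_add_const q)).intervalIntegrable _ _
  rw [key, key, add_comm]
  abel

lemma tendsto_inv_smul_average (g : L2) :
    Tendsto (fun s : ℝ => s⁻¹ • average s g) (𝓝[≠] 0) (𝓝 g) := by
  have h1 : HasDerivAt (fun r => average r g) (shift 0 g) 0 :=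
    (intervalIntegral.integral_hasDerivAt_right (intervalIntegrable_shift g _ _)
      ((continuous_shift g).stronglyMeasurableAtFilter _ _)
      (continuous_shift g).continuousAt)
  rw [shift_zero] at h1
  have := h1.tendsto_slope_zero
  simpa [average] using this

lemma average_sub (r : ℝ) (g h : L2) : average r (g - h) = average r g - average r h := by
  unfold average
  simp_rw [map_sub]
  exact intervalIntegral.integral_sub (intervalIntegrable_shift g _ _)
    (intervalIntegrable_shift h _ _)

lemma inner_average (r : ℝ) (g h : L2) :
    ⟪average r g, h⟫ = ⟪g, ∫ s in (0 : ℝ)..r, shift (-s) h⟫ := by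
  have h1 := (innerSL ℝ h).intervalIntegral_comp_comm (intervalIntegrable_shift g 0 r)
  have h2 := (innerSL ℝ g).intervalIntegral_comp_comm
    (((continuous_shift h).comp continuous_neg).intervalIntegrable (μ := volume) 0 r)
  simp only [innerSL_apply_apply, Function.comp_apply] at h1 h2
  rw [← h2, real_inner_comm]
  unfold average
  rw [← h1]
  congr 1
  ext s
  rw [real_inner_comm, inner_shift]

end L2

/-! ### Convolution as a bounded operator on L². -/

namespace L2

/-- Testing with the negative part of g gives minus its squared norm. The dual form of positivity
survives weak limits and Bochner integrals. -/
lemma nonneg_of_forall_inner_nonneg {g : L2} (h : ∀ k : L2, 0 ≤ k → 0 ≤ ⟪g, k⟫) : 0 ≤ g := by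
  have h1 : 0 ≤ ⟪g, (-g) ⊔ 0⟫ := h _ le_sup_right
  have h2 : ⟪g, (-g) ⊔ 0⟫ = -⟪(-g) ⊔ 0, (-g) ⊔ 0⟫ := by
    rw [inner_eq_integral, inner_eq_integral, ← integral_neg]
    apply integral_congr_ae
    filter_upwards [Lp.coeFn_sup (-g) 0, Lp.coeFn_neg g, Lp.coeFn_zero ℝ 2 (volume : Measure ℝ)]
      with x h1 h2 h3
    rw [h1, Pi.sup_apply, h2, h3, Pi.neg_apply, Pi.zero_apply]
    rcases le_total (-(g x)) 0 with h | h
    · rw [sup_eq_right.2 h]; ring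
    · rw [sup_eq_left.2 h]; ring
  have h3 : (-g) ⊔ 0 = 0 := by
    rw [real_inner_self_eq_norm_sq] at h2
    exact norm_eq_zero.1 (pow_eq_zero_iff two_ne_zero |>.1 (le_antisymm (by linarith) (sq_nonneg _)))
  have h4 : -g ≤ 0 := h3 ▸ le_sup_left
  simpa using h4

variable {k : ℝ → ℝ}

lemma integrable_smul_shift (hk : Integrable k) (g : L2) :
    Integrable fun t => k t • shift t g := by
  refine (hk.norm.mul_const ‖g‖).mono'
    (hk.1.smul (continuous_shift g).aestronglyMeasurable) (Eventually.of_forall fun t => ?_)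
  rw [norm_smul, LinearIsometry.norm_map]

/-- Convolution with an integrable kernel as a bounded operator on `L²`. -/
noncomputable def conv (k : ℝ → ℝ) (hk : Integrable k) : L2 →L[ℝ] L2 :=
  LinearMap.mkContinuous
    { toFun := fun g => ∫ t, k t • shift t g
      map_add' := fun g h => by
        simp_rw [map_add, smul_add]
        exact integral_add (integrable_smul_shift hk g) (integrable_smul_shift hk h)
      map_smul' := fun c g => by
        simp_rw [map_smul, RingHom.id_apply, smul_comm _ c]
        exact integral_smul c _ } (∫ t, ‖k t‖) (fun g => by
      refine (norm_integral_le_integral_norm _).trans_eq ?_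
      simp_rw [norm_smul, LinearIsometry.norm_map]
      exact integral_mul_const _ _)

lemma conv_apply (hk : Integrable k) (g : L2) : conv k hk g = ∫ t, k t • shift t g := rfl

lemma norm_conv_le (hk : Integrable k) : ‖conv k hk‖ ≤ ∫ t, ‖k t‖ :=
  LinearMap.mkContinuous_norm_le _ (integral_nonneg fun _ => norm_nonneg _) _

/-- Convolution is a Bochner integral of translates, so a bounded operator can be pulled inside the
integral. -/
lemma map_conv (hk : Integrable k) {B : L2 →L[ℝ] L2} (hB : ∀ t g, B (shift t g) = shift t (B g)) (g : L2) :
    B (conv k hk g) = conv k hk (B g) := by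
  rw [conv_apply, conv_apply, ← B.integral_comp_comm (integrable_smul_shift hk g)]
  simp_rw [map_smul, hB]

lemma conv_shift (hk : Integrable k) (s : ℝ) (g : L2) :
    conv k hk (shift s g) = shift s (conv k hk g) :=
  (map_conv hk (B := (shift s).toContinuousLinearMap)
    (fun t g => shift_comm s t g) g).symm

lemma inner_conv_eq (hk : Integrable k) (g h : L2) : ⟪conv k hk g, h⟫ = ∫ t, k t * ⟪shift t g, h⟫ := by
  rw [conv_apply, real_inner_comm, ← innerSL_apply_apply ℝ,
    ← (innerSL ℝ h).integral_comp_comm (integrable_smul_shift hk g)]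
  congr 1
  ext t
  simp [real_inner_comm]

lemma inner_conv (hk : Integrable k) (heven : ∀ᵐ x, k x = k (-x)) (g h : L2) :
    ⟪conv k hk g, h⟫ = ⟪g, conv k hk h⟫ := by
  rw [inner_conv_eq, real_inner_comm, inner_conv_eq,
    ← integral_neg_eq_self (fun t => k t * ⟪shift t h, g⟫)]
  apply integral_congr_ae
  filter_upwards [heven] with t ht
  rw [← ht, inner_shift, real_inner_comm]

lemma reflect_conv (hk : Integrable k) (heven : ∀ᵐ x, k x = k (-x)) (g : L2) :
    reflect (conv k hk g) = conv k hk (reflect g) := by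
  refine ext_inner_right ℝ fun h => ?_
  rw [inner_reflect, inner_conv_eq, inner_conv_eq,
    ← integral_neg_eq_self (fun t => k t * ⟪shift t (reflect g), h⟫)]
  apply integral_congr_ae
  filter_upwards [heven] with t ht
  rw [← ht, ← inner_reflect, reflect_shift]

lemma conv_nonneg (hk : Integrable k) (hpos : ∀ᵐ x, 0 ≤ k x) {g : L2} (hg : 0 ≤ g) : 0 ≤ conv k hk g := by
  refine nonneg_of_forall_inner_nonneg fun h hh => ?_
  rw [inner_conv_eq]
  apply integral_nonneg_of_ae
  filter_upwards [hpos] with t ht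
  exact mul_nonneg ht (inner_nonneg_of_nonneg (shift_nonneg t hg) hh)

/-- The hypothesis of Fubini's theorem for `coeFn_conv`. Finite measure of E is needed because g is
only square integrable. -/
lemma integrable_conv_integrand (hk : Integrable k) {E : Set ℝ} (hE : MeasurableSet E) (hE' : volume E ≠ ⊤) (g : L2) :
    Integrable (fun p : ℝ × ℝ => k p.2 * g (p.1 - p.2))
      ((volume.restrict E).prod (volume : Measure ℝ)) := by
  have hmeas : AEStronglyMeasurable (fun p : ℝ × ℝ => k p.2 * g (p.1 - p.2))
      ((volume.restrict E).prod (volume : Measure ℝ)) := by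
    have := AEStronglyMeasurable.convolution_integrand (ContinuousLinearMap.mul ℝ ℝ)
      (μ := (volume : Measure ℝ)) (ν := (volume : Measure ℝ)) hk.1 (Lp.aestronglyMeasurable g)
    exact this.mono_ac
      (Measure.AbsolutelyContinuous.prod Measure.absolutelyContinuous_restrict
        Measure.AbsolutelyContinuous.rfl)
  have hint : ∀ t : ℝ, IntegrableOn (fun x => g (x - t)) E := fun t => by
    have h1 : IntegrableOn (shift t g) E := by
      have : IsFiniteMeasure ((volume : Measure ℝ).restrict E) := ⟨by
        simpa using hE'.lt_top⟩
      exact ((Lp.memLp (shift t g)).restrict E).integrable (by norm_num)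
    exact h1.congr (ae_restrict_of_ae (coeFn_shift t g))
  rw [integrable_prod_iff' hmeas]
  refine ⟨Eventually.of_forall fun t => (hint t).const_mul (k t), ?_⟩
  have hbound : ∀ t : ℝ, ∫ x in E, ‖k t * g (x - t)‖ ≤
      ‖k t‖ * (‖indicatorConstLp 2 hE hE' (1 : ℝ)‖ * ‖g‖) := by
    intro t
    simp_rw [norm_mul]
    rw [integral_const_mul]
    gcongr
    calc ∫ x in E, ‖g (x - t)‖ = ∫ x in E, |shift t g| x := by
          apply integral_congr_ae
          apply ae_restrict_of_ae
          filter_upwards [coeFn_shift t g, Lp.coeFn_abs (shift t g)] with x h1 h2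
          rw [h2, h1, Real.norm_eq_abs]
      _ = ⟪indicatorConstLp 2 hE hE' (1 : ℝ), |shift t g|⟫ :=
          (L2.inner_indicatorConstLp_one (𝕜 := ℝ) hE hE' _).symm
      _ ≤ ‖indicatorConstLp 2 hE hE' (1 : ℝ)‖ * ‖|shift t g|‖ := real_inner_le_norm _ _
      _ = ‖indicatorConstLp 2 hE hE' (1 : ℝ)‖ * ‖g‖ := by
          rw [norm_abs_eq_norm, LinearIsometry.norm_map]
  refine (hk.norm.mul_const (‖indicatorConstLp 2 hE hE' (1 : ℝ)‖ * ‖g‖)).mono' ?_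
    (Eventually.of_forall fun t => ?_)
  · exact (hmeas.norm.prod_swap).integral_prod_right'
  · rw [Real.norm_of_nonneg (integral_nonneg fun _ => norm_nonneg _)]
    exact hbound t

lemma coeFn_conv (hk : Integrable k) (g : L2) : conv k hk g =ᵐ[volume] fun x => ∫ t, k t * g (x - t) := by
  refine ae_eq_of_forall_setIntegral_eq_of_sigmaFinite (fun E hE hE' => ?_) (fun E hE hE' => ?_)
    (fun E hE hE' => ?_)
  · have : IsFiniteMeasure ((volume : Measure ℝ).restrict E) := ⟨by simpa using hE'⟩
    exact ((Lp.memLp (conv k hk g)).restrict E).integrable (by norm_num)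
  · exact (integrable_conv_integrand hk hE hE'.ne g).integral_prod_left
  · rw [integral_integral_swap (integrable_conv_integrand hk hE hE'.ne g),
      ← L2.inner_indicatorConstLp_one (𝕜 := ℝ) hE hE'.ne, real_inner_comm, inner_conv_eq]
    congr 1
    ext t
    rw [integral_const_mul, real_inner_comm, L2.inner_indicatorConstLp_one]
    congr 1
    exact integral_congr_ae (ae_restrict_of_ae (coeFn_shift t g))

/-- For k in L² the convolution is an inner product with a translate of k, hence continuous in x and
bounded. All continuous representatives below come from this formula. -/
lemma integral_mul_comp_sub_eq_inner (hk2 : MemLp k 2) (heven : ∀ᵐ x, k x = k (-x))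
    (g : L2) (x : ℝ) : ∫ t, k t * g (x - t) = ⟪shift x (hk2.toLp k), g⟫ := by
  rw [inner_eq_integral, ← integral_sub_left_eq_self _ volume x]
  apply integral_congr_ae
  filter_upwards [coeFn_shift x (hk2.toLp k), ae_sub hk2.coeFn_toLp x, ae_sub heven x]
    with y h1 h2 h3
  rw [h1, h2, h3]
  congr 2 <;> ring

lemma coeFn_conv_eq_inner (hk : Integrable k) (hk2 : MemLp k 2) (heven : ∀ᵐ x, k x = k (-x))
    (g : L2) : conv k hk g =ᵐ[volume] fun x => ⟪shift x (hk2.toLp k), g⟫ := by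
  filter_upwards [coeFn_conv hk g] with x hx
  rw [hx, integral_mul_comp_sub_eq_inner hk2 heven]

lemma continuous_inner_shift (α g : L2) : Continuous fun x => ⟪shift x α, g⟫ :=
  (continuous_shift α).inner continuous_const

lemma coeFn_average (r : ℝ) (hr : 0 ≤ r) (g : L2) :
    average r g =ᵐ[volume] fun x => ∫ y in (x - r)..x, g y := by
  have hk : Integrable ((Set.Ioc 0 r).indicator (fun _ => (1 : ℝ))) :=
    (integrable_indicator_iff measurableSet_Ioc).2 (by simp)
  have h1 : average r g = conv _ hk g := by
    rw [conv_apply, average, intervalIntegral.integral_of_le hr, ← integral_indicator measurableSet_Ioc]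
    congr 1
    ext1 t
    by_cases ht : t ∈ Set.Ioc 0 r <;> simp [ht]
  rw [h1]
  filter_upwards [coeFn_conv hk g] with x hx
  rw [hx]
  have h2 : (fun t => (Set.Ioc 0 r).indicator (fun _ => (1 : ℝ)) t * g (x - t)) =
      (Set.Ioc 0 r).indicator fun t => g (x - t) := by
    ext1 t
    by_cases ht : t ∈ Set.Ioc 0 r <;> simp [ht]
  rw [h2, integral_indicator measurableSet_Ioc, ← intervalIntegral.integral_of_le hr,
    intervalIntegral.integral_comp_sub_left (fun y => g y) x, sub_zero]

end L2

/-! ### Compactness of Hilbert–Schmidt operators. -/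

section HilbertSchmidt

variable {E : Type*} [NormedAddCommGroup E] [InnerProductSpace ℝ E]

/-- The operator `h ↦ (x ↦ ⟪c x, h⟫)` associated with a square integrable family `c` of
vectors. -/
noncomputable def hilbertSchmidt : Lp E 2 (volume : Measure ℝ) →L[ℝ] E →L[ℝ] L2 :=
  LinearMap.mkContinuous₂
    (LinearMap.mk₂ ℝ (fun c h => (innerSL ℝ h).compLp c)
      (fun c c' h => (ContinuousLinearMap.compLpL 2 volume (innerSL ℝ h)).map_add c c')
      (fun r c h => (ContinuousLinearMap.compLpL 2 volume (innerSL ℝ h)).map_smul r c)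
      (fun c h h' => by rw [map_add, ContinuousLinearMap.add_compLp])
      (fun r c h => by rw [map_smul, ContinuousLinearMap.smul_compLp])) 1
    (fun c h => by
      have := ContinuousLinearMap.norm_compLp_le (innerSL ℝ h) c
      rw [innerSL_apply_norm] at this
      rw [one_mul, mul_comm]
      exact this)

lemma coeFn_hilbertSchmidt (c : Lp E 2 (volume : Measure ℝ)) (h : E) :
    hilbertSchmidt c h =ᵐ[volume] fun x => ⟪c x, h⟫ := by
  filter_upwards [ContinuousLinearMap.coeFn_compLp (innerSL ℝ h) c] with x hx
  rw [real_inner_comm, ← innerSL_apply_apply ℝ, ← hx]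
  rfl

/-- For an indicator with a constant vector the operator has rank one. Sums and norm limits preserve
compactness, and such families generate L². -/
lemma isCompactOperator_hilbertSchmidt (c : Lp E 2 (volume : Measure ℝ)) :
    IsCompactOperator (hilbertSchmidt c) := by
  refine Lp.induction (by norm_num) (fun c => IsCompactOperator (hilbertSchmidt c))
    ?_ ?_ ?_ c
  · intro e s hs hsμ
    let B : E →L[ℝ] L2 := (ContinuousLinearMap.toSpanSingleton ℝ
      (indicatorConstLp 2 hs hsμ.ne (1 : ℝ))).comp (innerSL ℝ e)
    have hB : hilbertSchmidt (indicatorConstLp 2 hs hsμ.ne e) = B := by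
      ext1 h
      apply Lp.ext
      filter_upwards [coeFn_hilbertSchmidt (indicatorConstLp 2 hs hsμ.ne e) h,
        indicatorConstLp_coeFn (p := 2) (hs := hs) (hμs := hsμ.ne) (c := e),
        indicatorConstLp_coeFn (p := 2) (hs := hs) (hμs := hsμ.ne) (c := (1 : ℝ)),
        Lp.coeFn_smul ⟪e, h⟫ (indicatorConstLp 2 hs hsμ.ne (1 : ℝ))] with x h1 h2 h3 h4
      have h5 : B h = ⟪e, h⟫ • indicatorConstLp 2 hs hsμ.ne (1 : ℝ) := by simp [B]
      rw [h5, h1, h2, h4, Pi.smul_apply, h3]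
      by_cases hx : x ∈ s <;> simp [hx]
    change IsCompactOperator (hilbertSchmidt (indicatorConstLp 2 hs hsμ.ne e))
    rw [hB]
    exact (isCompactOperator_of_locallyCompactSpace_rng
      (ContinuousLinearMap.toSpanSingleton ℝ (indicatorConstLp 2 hs hsμ.ne (1 : ℝ)))).comp_clm _
  · intro f g hf hg _ h1 h2
    rw [map_add]
    exact h1.add h2
  · exact isClosed_setOfPred_isCompactOperator.preimage hilbertSchmidt.continuous

end HilbertSchmidt

/-! ### Perron–Frobenius theory for selfadjoint positivity preserving operators. -/

namespace L2

lemma eq_zero_of_inner_eq_zero {E : Set ℝ} {p q : L2} (hp : ∀ᵐ x, x ∈ E → 0 < p x)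
    (hq : 0 ≤ q) (hqE : ∀ᵐ x, x ∉ E → q x = 0) (h : ⟪q, p⟫ = 0) : q = 0 := by
  rw [inner_eq_integral] at h
  rw [← Lp.coeFn_nonneg] at hq
  have h0 : 0 ≤ᵐ[volume] fun x => q x * p x := by
    filter_upwards [hp, hq, hqE] with x h1 h2 h3
    by_cases hx : x ∈ E
    · exact mul_nonneg h2 (h1 hx).le
    · simp [h3 hx]
  have h1 := (integral_eq_zero_iff_of_nonneg_ae h0 (integrable_mul q p)).1 h
  apply Lp.ext
  filter_upwards [h1, hp, hqE, Lp.coeFn_zero ℝ 2 (volume : Measure ℝ)] with x h2 h3 h4 h5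
  rw [h5, Pi.zero_apply]
  by_cases hx : x ∈ E
  · exact (mul_eq_zero.1 h2).resolve_right (h3 hx).ne'
  · exact h4 hx

variable {T : L2 →L[ℝ] L2}

lemma abs_map_le (hpos : ∀ g, 0 ≤ g → 0 ≤ T g) (g : L2) : |T g| ≤ T |g| := by
  have hmono : ∀ g h, g ≤ h → T g ≤ T h := fun g h hgh => by
    have := hpos (h - g) (sub_nonneg.2 hgh)
    rwa [map_sub, sub_nonneg] at this
  refine abs_le'.2 ⟨hmono _ _ (le_abs_self g), ?_⟩
  rw [← map_neg]
  exact hmono _ _ (neg_le_abs g)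

/-- Expand the square and use ⟪g, T²g⟫ = ‖Tg‖². Almost maximisers of ‖Tg‖ are thus almost fixed by
T². -/
lemma norm_sub_map_map_sq_le (hsa : ∀ g h, ⟪T g, h⟫ = ⟪g, T h⟫) (hT : ‖T‖ = 1) {g : L2}
    (hg : ‖g‖ ≤ 1) : ‖g - T (T g)‖ ^ 2 ≤ 2 - 2 * ‖T g‖ ^ 2 := by
  have h1 : ‖T (T g)‖ ≤ 1 := by
    calc ‖T (T g)‖ ≤ 1 * (1 * ‖g‖) := by
          rw [← hT]
          exact (T.le_opNorm _).trans (by gcongr; exact T.le_opNorm _)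
      _ ≤ 1 := by linarith
  have h2 : ⟪g, T (T g)⟫ = ‖T g‖ ^ 2 := by rw [← hsa, real_inner_self_eq_norm_sq]
  rw [norm_sub_sq_real, h2]
  nlinarith [norm_nonneg g, norm_nonneg (T (T g))]

/-- A compact selfadjoint positivity preserving operator of norm one has a nonnegative nontrivial
fixed point. -/
lemma exists_nonneg_fixed (hsa : ∀ g h, ⟪T g, h⟫ = ⟪g, T h⟫) (hpos : ∀ g, 0 ≤ g → 0 ≤ T g)
    (hcomp : IsCompactOperator T) (hT : ‖T‖ = 1) : ∃ p : L2, 0 ≤ p ∧ p ≠ 0 ∧ T p = p := by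
  have hex : ∀ n : ℕ, ∃ g : L2, ‖g‖ < 1 ∧ 1 - 1 / ((n : ℝ) + 1) < ‖T g‖ := fun n =>
    T.exists_lt_apply_of_lt_opNorm (by
      rw [hT]
      have : 0 < 1 / ((n : ℝ) + 1) := by positivity
      linarith)
  choose g hg1 hg2 using hex
  have hlim : Tendsto (fun n => ‖T (g n)‖) atTop (𝓝 1) := by
    have h1 : Tendsto (fun n : ℕ => 1 - 1 / ((n : ℝ) + 1)) atTop (𝓝 1) := by
      simpa using tendsto_const_nhds.sub (tendsto_one_div_add_atTop_nhds_zero_nat (𝕜 := ℝ))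
    refine tendsto_of_tendsto_of_tendsto_of_le_of_le h1 tendsto_const_nhds (fun n => (hg2 n).le)
      (fun n => ?_)
    have := T.le_opNorm (g n)
    rw [hT, one_mul] at this
    exact this.trans (hg1 n).le
  have hdiff : Tendsto (fun n => g n - T (T (g n))) atTop (𝓝 0) := by
    rw [tendsto_zero_iff_norm_tendsto_zero]
    have h1 : Tendsto (fun n => ‖g n - T (T (g n))‖ ^ 2) atTop (𝓝 0) := by
      refine squeeze_zero (fun _ => sq_nonneg _)
        (fun n => norm_sub_map_map_sq_le hsa hT (hg1 n).le) ?_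
      have := (tendsto_const_nhds (x := (2 : ℝ))).sub ((hlim.pow 2).const_mul 2)
      simpa using this
    have h2 := (Real.continuous_sqrt.tendsto 0).comp h1
    simpa [Function.comp_def, Real.sqrt_sq (norm_nonneg _)] using h2
  obtain ⟨K, hK, hKT⟩ := hcomp.image_subset_compact_of_bounded (f := T.toLinearMap)
    (Metric.isBounded_closedBall (x := (0 : L2)) (r := 1))
  have hmem : ∀ n, T (T (g n)) ∈ K := fun n => hKT ⟨T (g n), by
    have := T.le_opNorm (g n)
    rw [hT, one_mul] at this
    simpa using this.trans (hg1 n).le, rfl⟩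
  obtain ⟨y, -, φ, hφ, hy⟩ := hK.tendsto_subseq hmem
  have hgy : Tendsto (fun n => g (φ n)) atTop (𝓝 y) := by
    have := (hdiff.comp hφ.tendsto_atTop).add hy
    simpa [Function.comp_def] using this
  have hy1 : ‖y‖ ≤ 1 := le_of_tendsto' hgy.norm fun n => (hg1 _).le
  have hTy : ‖T y‖ = 1 :=
    tendsto_nhds_unique ((T.continuous.tendsto y).comp hgy).norm (hlim.comp hφ.tendsto_atTop)
  -- Passing to the absolute value keeps the maximum, since |T y| ≤ T |y|.
  have hTp : 1 ≤ ‖T |y|‖ := by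
    rw [← hTy]
    refine norm_le_norm_of_abs_le_abs ?_
    rw [abs_of_nonneg (hpos _ (abs_nonneg y))]
    exact abs_map_le hpos y
  have hfix : T (T |y|) = |y| := by
    have h1 := norm_sub_map_map_sq_le hsa hT (g := |y|) (by rwa [norm_abs_eq_norm])
    have h2 : ‖|y| - T (T |y|)‖ = 0 := by
      have h3 : ‖|y| - T (T |y|)‖ ^ 2 ≤ 0 := by nlinarith
      exact pow_eq_zero_iff two_ne_zero |>.1 (le_antisymm h3 (sq_nonneg _))
    exact (sub_eq_zero.1 (norm_eq_zero.1 h2)).symm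
  -- So far |y| is fixed only by T². Adding T |y| yields a fixed point of T, and nonnegativity of
  -- both summands prevents cancellation.
  refine ⟨|y| + T |y|, add_nonneg (abs_nonneg y) (hpos _ (abs_nonneg y)), fun h0 => ?_, ?_⟩
  · have h1 : |y| ≤ 0 := h0 ▸ le_add_of_nonneg_right (hpos _ (abs_nonneg y))
    have h2 : |y| = 0 := le_antisymm h1 (abs_nonneg y)
    rw [h2, map_zero, norm_zero] at hTp
    linarith
  · rw [map_add, hfix, add_comm]

/-- Fixed points of an irreducible selfadjoint positivity preserving operator are multiples of
a given nonnegative one. -/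
lemma exists_eq_smul_of_fixed {E : Set ℝ} (hsa : ∀ g h, ⟪T g, h⟫ = ⟪g, T h⟫)
    (hpos : ∀ g, 0 ≤ g → 0 ≤ T g) (hsupp : ∀ g, ∀ᵐ x, x ∉ E → T g x = 0)
    (hstrict : ∀ g, 0 ≤ g → T g = g → g ≠ 0 → ∀ᵐ x, x ∈ E → 0 < g x)
    {p h : L2} (hp : 0 ≤ p) (hp0 : p ≠ 0) (hTp : T p = p) (hTh : T h = h) :
    ∃ c : ℝ, h = c • p := by
  have hpE := hstrict p hp hTp hp0
  set c := ⟪h, p⟫ / ⟪p, p⟫ with hc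
  refine ⟨c, ?_⟩
  set d := h - c • p with hd
  have hTd : T d = d := by rw [hd, map_sub, map_smul, hTp, hTh]
  have hdp : ⟪d, p⟫ = 0 := by
    rw [hd, inner_sub_left, real_inner_smul_left, hc,
      div_mul_cancel₀ _ (inner_self_ne_zero.2 hp0), sub_self]
  have hdE : ∀ᵐ x, x ∉ E → d x = 0 := by
    have := hsupp d
    rwa [hTd] at this
  have habsE : ∀ᵐ x, x ∉ E → |d| x = 0 := by
    filter_upwards [hdE, Lp.coeFn_abs d] with x h1 h2 hx
    rw [h2, h1 hx, abs_zero]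
  -- The difference T |d| − |d| is nonnegative and, by selfadjointness, orthogonal to p, which is
  -- positive on E.
  have hTabs : T |d| = |d| := by
    rw [← sub_eq_zero]
    refine eq_zero_of_inner_eq_zero (E := E) hpE ?_ ?_ ?_
    · rw [sub_nonneg]
      have := abs_map_le hpos d
      rwa [hTd] at this
    · filter_upwards [Lp.coeFn_sub (T |d|) |d|, hsupp |d|, habsE] with x h1 h2 h3 hx
      rw [h1, Pi.sub_apply, h2 hx, h3 hx, sub_zero]
    · rw [inner_sub_left, hsa, hTp, sub_self]
  have hzero : ∀ q : L2, 0 ≤ q → (∀ᵐ x, x ∉ E → q x = 0) → ⟪q, p⟫ = 0 → q = 0 :=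
    fun q h1 h2 h3 => eq_zero_of_inner_eq_zero hpE h1 h2 h3
  have hp1 : 0 ≤ |d| + d := by
    have := sub_nonneg.2 (neg_le_abs d)
    rwa [sub_neg_eq_add] at this
  have hp2 : 0 ≤ |d| - d := sub_nonneg.2 (le_abs_self d)
  have hd0 : d = 0 := by
    -- If |d| + d or |d| − d vanishes, then d has one sign and is killed by orthogonality to p.
    -- Otherwise both are strictly positive a.e. on E, which would force d > 0 and d < 0 there.
    by_cases h1 : |d| + d = 0
    · have : -d = 0 := hzero (-d) (by rw [← eq_neg_of_add_eq_zero_left h1]; exact abs_nonneg d)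
        (by filter_upwards [hdE, Lp.coeFn_neg d] with x h1 h2 hx
            rw [h2, Pi.neg_apply, h1 hx, neg_zero]) (by rw [inner_neg_left, hdp, neg_zero])
      exact neg_eq_zero.1 this
    by_cases h2 : |d| - d = 0
    · exact hzero d (by rw [← sub_eq_zero.1 h2]; exact abs_nonneg d) hdE hdp
    have h3 := hstrict _ hp1 (by rw [map_add, hTd, hTabs]) h1
    have h4 := hstrict _ hp2 (by rw [map_sub, hTd, hTabs]) h2
    apply Lp.ext
    filter_upwards [h3, h4, hdE, Lp.coeFn_add |d| d, Lp.coeFn_sub |d| d, Lp.coeFn_abs d,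
      Lp.coeFn_zero ℝ 2 (volume : Measure ℝ)] with x h3 h4 h5 h6 h7 h8 h9
    rw [h9, Pi.zero_apply]
    refine h5 fun hx => ?_
    have h3 := h3 hx
    have h4 := h4 hx
    rw [h6, Pi.add_apply, h8] at h3
    rw [h7, Pi.sub_apply, h8] at h4
    rcases abs_cases (d x) with h | h <;> linarith
  exact sub_eq_zero.1 hd0

end L2

/-! ### The linear solution operator given by a Neumann series. -/

section Solver

variable {H : Type*} [NormedAddCommGroup H] [InnerProductSpace ℝ H] [CompleteSpace H]
  {A : H →L[ℝ] H} {c r : ℝ}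

/-- The solution operator `w ↦ u` of the linear equation `u = A (c • w + r • u)`, given by a
Neumann series. -/
noncomputable def solver (A : H →L[ℝ] H) (c r : ℝ) : H →L[ℝ] H :=
  A * (c • ∑' n : ℕ, (r • A) ^ n)

omit [CompleteSpace H] in
lemma norm_smul_lt_one (hA : ‖A‖ ≤ 1) (hr0 : 0 ≤ r) (hr1 : r < 1) : ‖r • A‖ < 1 := by
  rw [norm_smul, Real.norm_of_nonneg hr0]
  nlinarith [norm_nonneg A]

lemma neumann_eq (hA : ‖A‖ ≤ 1) (hr0 : 0 ≤ r) (hr1 : r < 1) (g : H) :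
    (∑' n : ℕ, (r • A) ^ n) g - r • A ((∑' n : ℕ, (r • A) ^ n) g) = g := by
  have h := DFunLike.congr_fun (mul_neg_geom_series (r • A) (norm_smul_lt_one hA hr0 hr1)) g
  simpa [sub_mul] using h

omit [CompleteSpace H] in
lemma solver_apply (g : H) : solver A c r g = c • A ((∑' n : ℕ, (r • A) ^ n) g) := by
  simp [solver]

lemma solver_eq (hA : ‖A‖ ≤ 1) (hr0 : 0 ≤ r) (hr1 : r < 1) (g : H) :
    solver A c r g = A (c • g + r • solver A c r g) := by
  set s := (∑' n : ℕ, (r • A) ^ n) g with hs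
  have h : s - r • A s = g := neumann_eq hA hr0 hr1 g
  rw [solver_apply, ← hs, ← map_smul]
  congr 1
  rw [← h, smul_sub, map_smul, smul_comm r c (A s)]
  abel

/-- The difference of two solutions is reproduced by r • A, a strict contraction. -/
lemma eq_solver (hA : ‖A‖ ≤ 1) (hr0 : 0 ≤ r) (hr1 : r < 1) {u w : H}
    (h : u = A (c • w + r • u)) : u = solver A c r w := by
  have h1 : u - solver A c r w = r • A (u - solver A c r w) := by
    have h0 : c • w + r • u - (c • w + r • solver A c r w) = r • (u - solver A c r w) := by
      rw [smul_sub]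
      abel
    calc u - solver A c r w = A (c • w + r • u) - A (c • w + r • solver A c r w) := by
          rw [← h, ← solver_eq hA hr0 hr1]
      _ = r • A (u - solver A c r w) := by rw [← map_sub, h0, map_smul]
  have h2 : ‖u - solver A c r w‖ ≤ r * ‖u - solver A c r w‖ := by
    conv_lhs => rw [h1, norm_smul, Real.norm_of_nonneg hr0]
    gcongr
    exact (A.le_opNorm _).trans (by nlinarith [norm_nonneg (u - solver A c r w)])
  have h3 : ‖u - solver A c r w‖ = 0 := by
    nlinarith [norm_nonneg (u - solver A c r w)]
  exact sub_eq_zero.1 (norm_eq_zero.1 h3)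

/-- The image under B solves the equation with datum B g, so uniqueness applies and the series need
not be touched. -/
lemma map_solver (hA : ‖A‖ ≤ 1) (hr0 : 0 ≤ r) (hr1 : r < 1) {B : H →L[ℝ] H}
    (hB : ∀ g, B (A g) = A (B g)) (g : H) : B (solver A c r g) = solver A c r (B g) := by
  refine eq_solver hA hr0 hr1 ?_
  conv_lhs => rw [solver_eq hA hr0 hr1]
  rw [hB, map_add, map_smul, map_smul]

lemma inner_solver (hA : ‖A‖ ≤ 1) (hr0 : 0 ≤ r) (hr1 : r < 1)
    (hsa : ∀ g h, ⟪A g, h⟫ = ⟪g, A h⟫) (g h : H) :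
    ⟪solver A c r g, h⟫ = ⟪g, solver A c r h⟫ := by
  rw [solver_apply, solver_apply]
  set s := (∑' n : ℕ, (r • A) ^ n) g with hs
  set t := (∑' n : ℕ, (r • A) ^ n) h with ht
  have h1 : s - r • A s = g := neumann_eq hA hr0 hr1 g
  have h2 : t - r • A t = h := neumann_eq hA hr0 hr1 h
  rw [← h1, ← h2]
  simp only [inner_sub_left, inner_sub_right, real_inner_smul_left, real_inner_smul_right, hsa]
  ring

/-- Every partial sum of the Neumann series stays in the cone, which is closed. -/
lemma solver_mem {C : Set H} (hC : IsClosed C) (h0 : (0 : H) ∈ C)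
    (hadd : ∀ g ∈ C, ∀ h ∈ C, g + h ∈ C) (hsmul : ∀ t : ℝ, 0 ≤ t → ∀ g ∈ C, t • g ∈ C)
    (hAC : ∀ g ∈ C, A g ∈ C) (hA : ‖A‖ ≤ 1) (hc : 0 ≤ c) (hr0 : 0 ≤ r) (hr1 : r < 1)
    {g : H} (hg : g ∈ C) : solver A c r g ∈ C := by
  have hpow : ∀ n : ℕ, ((r • A) ^ n) g ∈ C := by
    intro n
    induction n with
    | zero => simpa using hg
    | succ n ih =>
      rw [pow_succ']
      exact hsmul r hr0 _ (hAC _ ih)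
  have hsum : HasSum (fun n : ℕ => ((r • A) ^ n) g) ((∑' n : ℕ, (r • A) ^ n) g) := by
    have h1 := (summable_geometric_of_norm_lt_one (norm_smul_lt_one hA hr0 hr1)).hasSum
    exact h1.mapL (ContinuousLinearMap.apply ℝ H g)
  have hpart : ∀ s : Finset ℕ, ∑ n ∈ s, ((r • A) ^ n) g ∈ C := by
    intro s
    induction s using Finset.induction_on with
    | empty => simpa using h0
    | insert n s hn ih =>
      rw [Finset.sum_insert hn]
      exact hadd _ (hpow n) _ ih
  rw [solver_apply]
  exact hsmul c hc _ (hAC _ (hC.mem_of_tendsto hsum (Eventually.of_forall hpart)))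

end Solver

/-! ### Odd functions and the cone of those nonnegative on the half-line. -/

namespace L2

/-- The closed convex cone of odd functions that are nonnegative on the positive half-line. -/
def oddCone : Set L2 := {g : L2 | reflect g = (-g : L2) ∧ 0 ≤ cut (Set.Ioi 0) measurableSet_Ioi g}

lemma isClosed_oddCone : IsClosed oddCone := by
  have h1 : Continuous fun g : L2 => reflect g + g := reflect.continuous.add continuous_id
  have h2 : IsClosed {g : L2 | reflect g + g = 0} := isClosed_singleton.preimage h1
  have h3 : IsClosed {g : L2 | 0 ≤ cut (Set.Ioi 0) measurableSet_Ioi g} :=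
    isClosed_le continuous_const (cut (Set.Ioi 0) measurableSet_Ioi).continuous
  have h4 : oddCone = {g : L2 | reflect g + g = 0} ∩
      {g : L2 | 0 ≤ cut (Set.Ioi 0) measurableSet_Ioi g} := by
    ext g
    simp only [oddCone, Set.mem_ofPred_eq, Set.mem_inter_iff, add_eq_zero_iff_eq_neg]
  rw [h4]
  exact h2.inter h3

lemma zero_mem_oddCone : (0 : L2) ∈ oddCone := by simp [oddCone]

lemma add_mem_oddCone (g : L2) (hg : g ∈ oddCone) (h : L2) (hh : h ∈ oddCone) :
    g + h ∈ oddCone := by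
  refine ⟨?_, ?_⟩
  · rw [map_add, hg.1, hh.1, neg_add]
  · rw [map_add]
    exact add_nonneg hg.2 hh.2

lemma smul_nonneg_of_nonneg {t : ℝ} (ht : 0 ≤ t) {g : L2} (hg : 0 ≤ g) : 0 ≤ t • g := by
  rw [← Lp.coeFn_nonneg] at hg ⊢
  filter_upwards [hg, Lp.coeFn_smul t g] with x h1 h2
  rw [h2]
  exact mul_nonneg ht h1

lemma smul_mem_oddCone (t : ℝ) (ht : 0 ≤ t) (g : L2) (hg : g ∈ oddCone) :
    t • g ∈ oddCone := by
  refine ⟨?_, ?_⟩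
  · rw [map_smul, hg.1, smul_neg]
  · rw [map_smul]
    exact smul_nonneg_of_nonneg ht hg.2

lemma ae_nonneg_of_mem_oddCone {g : L2} (hg : g ∈ oddCone) : ∀ᵐ x, 0 < x → 0 ≤ g x := by
  have := hg.2
  rw [← Lp.coeFn_nonneg] at this
  filter_upwards [this, coeFn_cut measurableSet_Ioi g] with x h1 h2 hx
  rw [h2, Set.indicator_of_mem (Set.mem_Ioi.2 hx)] at h1
  exact h1

lemma ae_odd_of_mem_oddCone {g : L2} (hg : g ∈ oddCone) : ∀ᵐ x, g (-x) = -g x := by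
  filter_upwards [coeFn_reflect g, Lp.coeFn_neg g] with x h1 h2
  rw [← h1, hg.1, h2, Pi.neg_apply]

/-- The odd function `x ↦ p x - p (-x)`. -/
noncomputable def oddPart : L2 →L[ℝ] L2 :=
  ContinuousLinearMap.id ℝ L2 - reflect.toContinuousLinearMap

lemma oddPart_apply (p : L2) : oddPart p = p - reflect p := rfl

lemma inner_oddPart (g h : L2) : ⟪oddPart g, h⟫ = ⟪g, oddPart h⟫ := by
  rw [oddPart_apply, oddPart_apply, inner_sub_left, inner_sub_right, inner_reflect]

lemma reflect_oddPart (p : L2) : reflect (oddPart p) = -oddPart p := by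
  rw [oddPart_apply, map_sub, reflect_reflect, neg_sub]

lemma coeFn_oddPart (p : L2) : oddPart p =ᵐ[volume] fun x => p x - p (-x) := by
  filter_upwards [Lp.coeFn_sub p (reflect p), coeFn_reflect p] with x h1 h2
  rw [oddPart_apply, h1, Pi.sub_apply, h2]

/-- The condition that a function vanishes on the negative half-line. -/
def SupportedOnPos (p : L2) : Prop := ∀ᵐ x, x ≤ 0 → p x = 0

lemma supportedOnPos_cut {E : Set ℝ} (hE : MeasurableSet E) (hE0 : E ⊆ Set.Ioi 0) (g : L2) :
    SupportedOnPos (cut E hE g) := by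
  filter_upwards [coeFn_cut hE g] with x hx hx0
  rw [hx, Set.indicator_of_notMem]
  exact fun h => not_lt.2 hx0 (hE0 h)

lemma ae_ne (t : ℝ) : ∀ᵐ x : ℝ, x ≠ t := by
  rw [ae_iff]
  simp

lemma coeFn_oddPart_of_supportedOnPos {p : L2} (hp : SupportedOnPos p) :
    ∀ᵐ x, 0 < x → oddPart p x = p x := by
  filter_upwards [coeFn_oddPart p, ae_neg hp] with x h1 h2 hx
  rw [h1, h2 (by linarith), sub_zero]

lemma oddPart_mem_oddCone {p : L2} (hp : 0 ≤ p) (hp0 : SupportedOnPos p) :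
    oddPart p ∈ oddCone := by
  refine ⟨reflect_oddPart p, ?_⟩
  rw [← Lp.coeFn_nonneg] at hp ⊢
  filter_upwards [hp, coeFn_cut measurableSet_Ioi (oddPart p),
    coeFn_oddPart_of_supportedOnPos hp0] with x h1 h2 h3
  rw [h2]
  by_cases hx : x ∈ Set.Ioi (0 : ℝ)
  · rw [Set.indicator_of_mem hx, h3 hx]
    exact h1
  · rw [Set.indicator_of_notMem hx]
    rfl

lemma oddPart_cut_eq {g : L2} (hg : ∀ᵐ x, g (-x) = -g x) :
    oddPart (cut (Set.Ioi 0) measurableSet_Ioi g) = g := by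
  apply Lp.ext
  have h0 := coeFn_cut (measurableSet_Ioi (a := (0 : ℝ))) g
  filter_upwards [coeFn_oddPart (cut (Set.Ioi 0) measurableSet_Ioi g), h0, ae_neg h0, hg,
    ae_ne 0] with x h1 h2 h3 h4 h5
  rw [h1, h2, h3]
  rcases lt_or_gt_of_ne h5 with h | h
  · rw [Set.indicator_of_notMem (by simpa using h.le), Set.indicator_of_mem (by simpa using h), h4]
    ring
  · rw [Set.indicator_of_mem (by simpa using h), Set.indicator_of_notMem (by simpa using h.le),
      sub_zero]

end L2

/-! ### Positivity, compactness and smoothing of convolution with the kernel and of its solver. -/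

namespace IsAdmissibleKernel

open L2

variable {a : ℝ → ℝ}

lemma even (ha : IsAdmissibleKernel a) : ∀ᵐ x, a x = a (-x) := ha.mem_cone.2.1

lemma memLp (ha : IsAdmissibleKernel a) : MemLp a 2 := ha.mem_cone.1

lemma strictAntiOn (ha : IsAdmissibleKernel a) : StrictAntiOn a (Set.Ioi 0) := by
  refine strictAntiOn_of_deriv_neg (convex_Ioi 0)
    (fun x hx => (ha.differentiableAt x hx).continuousAt.continuousWithinAt) (fun x hx => ?_)
  rw [interior_Ioi] at hx
  exact ha.deriv_neg x hx

/-- Membership in the cone controls only almost all pairs. These pairs are dense, so some pair has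
second entry beyond x, and strict decrease carries its nonnegative value back to x. -/
lemma pos (ha : IsAdmissibleKernel a) {x : ℝ} (hx : 0 < x) : 0 < a x := by
  have hU : IsOpen ({p : ℝ × ℝ | 0 < p.1} ∩ {p : ℝ × ℝ | p.1 < p.2} ∩ {p : ℝ × ℝ | x < p.2}) :=
    ((isOpen_lt continuous_const continuous_fst).inter
      (isOpen_lt continuous_fst continuous_snd)).inter (isOpen_lt continuous_const continuous_snd)
  obtain ⟨p, ⟨⟨h1, h2⟩, h3⟩, h4⟩ := (Measure.dense_of_ae ha.mem_cone.2.2).inter_open_nonempty _ hU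
    ⟨(x, x + 1), ⟨hx, by simp⟩, by simp⟩
  have h5 : 0 ≤ a p.2 := (h4 h1 h2).2
  exact h5.trans_lt (ha.strictAntiOn hx (hx.trans h3) h3)

lemma ae_eq_abs (ha : IsAdmissibleKernel a) : ∀ᵐ x, a x = a |x| := by
  filter_upwards [ha.even] with x hx
  rcases abs_choice x with h | h <;> rw [h]
  exact hx

lemma ae_pos (ha : IsAdmissibleKernel a) : ∀ᵐ x, 0 < a x := by
  filter_upwards [ha.ae_eq_abs, ae_ne 0] with x h1 h2
  rw [h1]
  exact ha.pos (abs_pos.2 h2)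

/-- Convolution with the kernel. -/
noncomputable def op (ha : IsAdmissibleKernel a) : L2 →L[ℝ] L2 := conv a ha.integrable

/-- The kernel as a square integrable function. -/
noncomputable def vec (ha : IsAdmissibleKernel a) : L2 := ha.memLp.toLp a

lemma norm_op_le (ha : IsAdmissibleKernel a) : ‖ha.op‖ ≤ 1 := by
  refine (norm_conv_le ha.integrable).trans_eq ?_
  rw [← ha.integral_eq_one]
  apply integral_congr_ae
  filter_upwards [ha.ae_pos] with x hx
  exact Real.norm_of_nonneg hx.le

lemma inner_op (ha : IsAdmissibleKernel a) (g h : L2) : ⟪ha.op g, h⟫ = ⟪g, ha.op h⟫ :=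
  inner_conv ha.integrable ha.even g h

lemma shift_op (ha : IsAdmissibleKernel a) (t : ℝ) (g : L2) :
    shift t (ha.op g) = ha.op (shift t g) :=
  (conv_shift ha.integrable t g).symm

lemma reflect_op (ha : IsAdmissibleKernel a) (g : L2) :
    reflect (ha.op g) = ha.op (reflect g) :=
  reflect_conv ha.integrable ha.even g

lemma coeFn_op (ha : IsAdmissibleKernel a) (g : L2) :
    ha.op g =ᵐ[volume] fun x => ⟪shift x ha.vec, g⟫ :=
  coeFn_conv_eq_inner ha.integrable ha.memLp ha.even g

lemma convolution_eq (ha : IsAdmissibleKernel a) (g : L2) (x : ℝ) :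
    convolution a g (ContinuousLinearMap.mul ℝ ℝ) volume x = ⟪shift x ha.vec, g⟫ :=
  integral_mul_comp_sub_eq_inner ha.memLp ha.even g x

lemma abs_inner_vec_le (ha : IsAdmissibleKernel a) (x : ℝ) (g : L2) :
    |⟪shift x ha.vec, g⟫| ≤ ‖ha.vec‖ * ‖g‖ := by
  have := abs_real_inner_le_norm (shift x ha.vec) g
  rwa [LinearIsometry.norm_map] at this

lemma ae_pos_shift_vec (ha : IsAdmissibleKernel a) (x : ℝ) :
    ∀ᵐ y, 0 < shift x ha.vec y := by
  filter_upwards [coeFn_shift x ha.vec, ae_sub ha.memLp.coeFn_toLp x, ae_sub ha.ae_pos x]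
    with y h1 h2 h3
  rw [h1]
  exact h2 ▸ h3

/-- On odd functions, written on the half-line, convolution has the kernel a(x − y) − a(x + y). It
is positive because |y − x| < y + x and a decreases strictly. -/
lemma ae_pos_oddPart_vec (ha : IsAdmissibleKernel a) {x : ℝ} (hx : 0 < x) :
    ∀ᵐ y, y ∈ Set.Ioi (0 : ℝ) → 0 < oddPart (shift x ha.vec) y := by
  have h0 := coeFn_shift x ha.vec
  have h1 : ∀ᵐ y, ha.vec y = a |y| := by
    filter_upwards [ha.memLp.coeFn_toLp, ha.ae_eq_abs] with y h1 h2
    rw [← h2, ← h1]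
    rfl
  filter_upwards [coeFn_oddPart (shift x ha.vec), h0, ae_neg h0, ae_sub h1 x,
    ae_neg (ae_sub h1 x), ae_ne x] with y h2 h3 h4 h5 h6 h7 hy
  have hy : 0 < y := hy
  rw [h2, h3, h4, h5, h6, sub_pos]
  have h8 : |(-y - x)| = y + x := by
    rw [abs_of_neg (by linarith)]
    ring
  rw [h8]
  refine ha.strictAntiOn (abs_pos.2 (sub_ne_zero.2 h7)) (add_pos hy hx) ?_
  rw [abs_lt]
  constructor <;> linarith

lemma inner_vec_oddPart_nonneg (ha : IsAdmissibleKernel a) {x : ℝ} (hx : 0 < x) {p : L2}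
    (hp : 0 ≤ p) (hp0 : SupportedOnPos p) : 0 ≤ ⟪shift x ha.vec, oddPart p⟫ := by
  rw [← inner_oddPart, inner_eq_integral]
  rw [← Lp.coeFn_nonneg] at hp
  apply integral_nonneg_of_ae
  filter_upwards [ha.ae_pos_oddPart_vec hx, hp, hp0] with y h1 h2 h3
  rcases le_or_gt y 0 with hy | hy
  · simp [h3 hy]
  · exact mul_nonneg (h1 hy).le h2

lemma inner_vec_oddPart_pos (ha : IsAdmissibleKernel a) {x : ℝ} (hx : 0 < x) {p : L2}
    (hp : 0 ≤ p) (hp0 : SupportedOnPos p) (hne : p ≠ 0) :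
    0 < ⟪shift x ha.vec, oddPart p⟫ := by
  refine lt_of_le_of_ne (ha.inner_vec_oddPart_nonneg hx hp hp0) fun h => hne ?_
  rw [← inner_oddPart, real_inner_comm] at h
  refine eq_zero_of_inner_eq_zero (ha.ae_pos_oddPart_vec hx) hp ?_ h.symm
  filter_upwards [hp0] with y h1 h2
  exact h1 (by simpa using h2)

lemma inner_vec_nonneg_of_mem_oddCone (ha : IsAdmissibleKernel a) {x : ℝ} (hx : 0 < x) {g : L2}
    (hg : g ∈ oddCone) : 0 ≤ ⟪shift x ha.vec, g⟫ := by
  rw [← oddPart_cut_eq (ae_odd_of_mem_oddCone hg)]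
  exact ha.inner_vec_oddPart_nonneg hx hg.2 (supportedOnPos_cut _ subset_rfl g)

lemma op_mem_oddCone (ha : IsAdmissibleKernel a) (g : L2) (hg : g ∈ oddCone) :
    ha.op g ∈ oddCone := by
  refine ⟨by rw [reflect_op, hg.1, map_neg], ?_⟩
  rw [← Lp.coeFn_nonneg]
  filter_upwards [coeFn_cut measurableSet_Ioi (ha.op g), ha.coeFn_op g] with x h1 h2
  rw [h1]
  by_cases hx : x ∈ Set.Ioi (0 : ℝ)
  · rw [Set.indicator_of_mem hx, h2]
    exact ha.inner_vec_nonneg_of_mem_oddCone hx hg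
  · rw [Set.indicator_of_notMem hx]
    rfl

lemma op_nonneg (ha : IsAdmissibleKernel a) {g : L2} (hg : 0 ≤ g) : 0 ≤ ha.op g :=
  conv_nonneg ha.integrable (ha.ae_pos.mono fun _ h => h.le) hg

lemma inner_vec_pos (ha : IsAdmissibleKernel a) (x : ℝ) {g : L2} (hg : 0 ≤ g) (hg0 : g ≠ 0) :
    0 < ⟪shift x ha.vec, g⟫ := by
  have h0 : 0 ≤ shift x ha.vec := by
    rw [← Lp.coeFn_nonneg]
    exact (ha.ae_pos_shift_vec x).mono fun _ h => h.le
  refine lt_of_le_of_ne (inner_nonneg_of_nonneg h0 hg) fun h => hg0 ?_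
  rw [real_inner_comm] at h
  exact eq_zero_of_inner_eq_zero (E := Set.univ)
    ((ha.ae_pos_shift_vec x).mono fun _ h _ => h) hg (Eventually.of_forall (by simp)) h.symm

/-- The translates of the kernel all have the same norm, so they form a square integrable family
over a set of finite measure. -/
lemma isCompactOperator_cut_op (ha : IsAdmissibleKernel a) {E : Set ℝ} (hE : MeasurableSet E)
    (hE' : volume E ≠ ⊤) : IsCompactOperator (cut E hE ∘L ha.op) := by
  have hmem : MemLp (E.indicator fun x => shift x ha.vec) 2 (volume : Measure ℝ) := by
    rw [memLp_indicator_iff_restrict hE]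
    have : IsFiniteMeasure ((volume : Measure ℝ).restrict E) := ⟨by simpa using hE'.lt_top⟩
    refine MemLp.of_bound (continuous_shift ha.vec).aestronglyMeasurable ‖ha.vec‖
      (Eventually.of_forall fun x => ?_)
    rw [LinearIsometry.norm_map]
  have h : cut E hE ∘L ha.op = hilbertSchmidt (hmem.toLp _) := by
    ext1 g
    apply Lp.ext
    filter_upwards [coeFn_cut hE (ha.op g), ha.coeFn_op g,
      coeFn_hilbertSchmidt (hmem.toLp _) g, hmem.coeFn_toLp] with x h1 h2 h3 h4
    rw [ContinuousLinearMap.comp_apply, h1, h3, h4]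
    by_cases hx : x ∈ E <;> simp [hx, h2]
  rw [h]
  exact isCompactOperator_hilbertSchmidt _

variable {c r : ℝ}

lemma shift_solver (ha : IsAdmissibleKernel a) (hr0 : 0 ≤ r) (hr1 : r < 1) (t : ℝ) (g : L2) :
    shift t (solver ha.op c r g) = solver ha.op c r (shift t g) :=
  map_solver ha.norm_op_le hr0 hr1 (B := (shift t).toContinuousLinearMap)
    (ha.shift_op t) g

lemma reflect_solver (ha : IsAdmissibleKernel a) (hr0 : 0 ≤ r) (hr1 : r < 1) (g : L2) :
    reflect (solver ha.op c r g) = solver ha.op c r (reflect g) :=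
  map_solver ha.norm_op_le hr0 hr1 (B := reflect.toContinuousLinearMap) ha.reflect_op g

lemma oddPart_solver (ha : IsAdmissibleKernel a) (hr0 : 0 ≤ r) (hr1 : r < 1) (g : L2) :
    oddPart (solver ha.op c r g) = solver ha.op c r (oddPart g) := by
  rw [oddPart_apply, oddPart_apply, map_sub, ha.reflect_solver hr0 hr1]

lemma solver_mem_oddCone (ha : IsAdmissibleKernel a) (hc : 0 ≤ c) (hr0 : 0 ≤ r) (hr1 : r < 1)
    {g : L2} (hg : g ∈ oddCone) : solver ha.op c r g ∈ oddCone :=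
  solver_mem isClosed_oddCone zero_mem_oddCone add_mem_oddCone smul_mem_oddCone
    ha.op_mem_oddCone ha.norm_op_le hc hr0 hr1 hg

lemma solver_nonneg (ha : IsAdmissibleKernel a) (hc : 0 ≤ c) (hr0 : 0 ≤ r) (hr1 : r < 1)
    {g : L2} (hg : 0 ≤ g) : 0 ≤ solver ha.op c r g :=
  solver_mem (C := Set.Ici (0 : L2)) isClosed_Ici Set.self_mem_Ici
    (fun _ h1 _ h2 => Set.mem_Ici.2 (add_nonneg (Set.mem_Ici.1 h1) (Set.mem_Ici.1 h2)))
    (fun _ ht _ h => Set.mem_Ici.2 (smul_nonneg_of_nonneg ht (Set.mem_Ici.1 h)))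
    (fun _ h => Set.mem_Ici.2 (ha.op_nonneg (Set.mem_Ici.1 h))) ha.norm_op_le hc hr0 hr1
    (Set.mem_Ici.2 hg)

/-- The continuous representative of `solver ha.op c r g`. -/
noncomputable def rep (ha : IsAdmissibleKernel a) (c r : ℝ) (g : L2) (x : ℝ) : ℝ :=
  ⟪shift x ha.vec, c • g + r • solver ha.op c r g⟫

lemma continuous_rep (ha : IsAdmissibleKernel a) (g : L2) : Continuous (ha.rep c r g) :=
  continuous_inner_shift _ _

lemma coeFn_solver (ha : IsAdmissibleKernel a) (hr0 : 0 ≤ r) (hr1 : r < 1) (g : L2) :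
    solver ha.op c r g =ᵐ[volume] ha.rep c r g := by
  have h := ha.coeFn_op (c • g + r • solver ha.op c r g)
  rwa [← solver_eq ha.norm_op_le hr0 hr1] at h

lemma abs_rep_le (ha : IsAdmissibleKernel a) (hc : 0 ≤ c) (hr0 : 0 ≤ r) (g : L2) (x : ℝ) :
    |ha.rep c r g x| ≤ ‖ha.vec‖ * (c + r * ‖solver ha.op c r‖) * ‖g‖ := by
  refine (ha.abs_inner_vec_le x _).trans ?_
  rw [mul_assoc]
  gcongr
  refine (norm_add_le _ _).trans ?_
  rw [norm_smul, norm_smul, Real.norm_of_nonneg hc, Real.norm_of_nonneg hr0, add_mul, mul_assoc]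
  gcongr
  exact ContinuousLinearMap.le_opNorm _ _

lemma rep_pos_of_nonneg (ha : IsAdmissibleKernel a) (hc : 0 < c) (hr0 : 0 ≤ r) (hr1 : r < 1)
    {g : L2} (hg : 0 ≤ g) (hg0 : g ≠ 0) (x : ℝ) : 0 < ha.rep c r g x := by
  have h1 := ha.inner_vec_pos x hg hg0
  have h2 : 0 ≤ ⟪shift x ha.vec, solver ha.op c r g⟫ := by
    refine inner_nonneg_of_nonneg ?_ (ha.solver_nonneg hc.le hr0 hr1 hg)
    rw [← Lp.coeFn_nonneg]
    exact (ha.ae_pos_shift_vec x).mono fun _ h => h.le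
  rw [rep, inner_add_right, real_inner_smul_right, real_inner_smul_right]
  positivity

lemma rep_oddPart_pos (ha : IsAdmissibleKernel a) (hc : 0 < c) (hr0 : 0 ≤ r) (hr1 : r < 1)
    {p : L2} (hp : 0 ≤ p) (hp0 : SupportedOnPos p) (hne : p ≠ 0) {x : ℝ} (hx : 0 < x) :
    0 < ha.rep c r (oddPart p) x := by
  have h1 := ha.inner_vec_oddPart_pos hx hp hp0 hne
  have h2 := ha.inner_vec_nonneg_of_mem_oddCone hx
    (ha.solver_mem_oddCone hc.le hr0 hr1 (oddPart_mem_oddCone hp hp0))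
  rw [rep, inner_add_right, real_inner_smul_right, real_inner_smul_right]
  positivity

/-- Duality: the solver is selfadjoint and bounded from L² to L^∞ by `abs_rep_le`, hence from L¹ to
L² with the same constant. -/
lemma norm_solver_le_integral (ha : IsAdmissibleKernel a) (hc : 0 ≤ c) (hr0 : 0 ≤ r)
    (hr1 : r < 1) {h : L2} (hh : Integrable h) :
    ‖solver ha.op c r h‖ ≤ ‖ha.vec‖ * (c + r * ‖solver ha.op c r‖) * ∫ x, |h x| := by
  set u := solver ha.op c r h with hu
  set M := ‖ha.vec‖ * (c + r * ‖solver ha.op c r‖) with hM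
  have hM0 : 0 ≤ M := by positivity
  have h1 : ‖u‖ ^ 2 ≤ (M * ∫ x, |h x|) * ‖u‖ := by
    calc ‖u‖ ^ 2 = ⟪h, solver ha.op c r u⟫ := by
          rw [← inner_solver ha.norm_op_le hr0 hr1 ha.inner_op, ← hu, real_inner_self_eq_norm_sq]
      _ = ∫ x, h x * solver ha.op c r u x := inner_eq_integral _ _
      _ ≤ ∫ x, |h x| * (M * ‖u‖) := by
          refine integral_mono_ae (integrable_mul _ _) (hh.abs.mul_const _) ?_
          filter_upwards [ha.coeFn_solver (c := c) hr0 hr1 u] with x hx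
          rw [hx]
          refine (le_abs_self _).trans ?_
          rw [abs_mul]
          gcongr
          exact ha.abs_rep_le hc hr0 u x
      _ = (M * ∫ x, |h x|) * ‖u‖ := by
          rw [integral_mul_const]
          ring
  rcases (norm_nonneg u).eq_or_lt with h0 | h0
  · rw [← h0]
    exact mul_nonneg hM0 (integral_nonneg fun _ => abs_nonneg _)
  · rw [pow_two] at h1
    exact le_of_mul_le_mul_right h1 h0

lemma norm_cut_solver_le (ha : IsAdmissibleKernel a) (hc : 0 ≤ c) (hr0 : 0 ≤ r)
    (hr1 : r < 1) {E : Set ℝ} (hE : MeasurableSet E) (hE' : volume E ≠ ⊤) (g : L2) :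
    ‖cut E hE (solver ha.op c r g)‖ ≤
      ‖ha.vec‖ * (c + r * ‖solver ha.op c r‖) * ‖g‖ * √(volume.real E) := by
  set M := ‖ha.vec‖ * (c + r * ‖solver ha.op c r‖) * ‖g‖ with hM
  have hM0 : 0 ≤ M := by positivity
  have h1 : ‖indicatorConstLp 2 hE hE' M‖ = M * √(volume.real E) := by
    rw [norm_indicatorConstLp (by norm_num) (by norm_num), Real.norm_of_nonneg hM0,
      Real.sqrt_eq_rpow]
    norm_num
  rw [← h1]
  apply Lp.norm_le_norm_of_ae_le
  filter_upwards [coeFn_cut hE (solver ha.op c r g), ha.coeFn_solver (c := c) hr0 hr1 g,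
    indicatorConstLp_coeFn (p := 2) (hs := hE) (hμs := hE') (c := M)] with x h1 h2 h3
  rw [h1, h3]
  by_cases hx : x ∈ E
  · rw [Set.indicator_of_mem hx, Set.indicator_of_mem hx, h2, Real.norm_of_nonneg hM0]
    exact ha.abs_rep_le hc hr0 g x
  · simp [hx]

end IsAdmissibleKernel

/-! ### The truncated operator and the dependence of its norm on the interval. -/

namespace IsAdmissibleKernel

open L2

variable {a : ℝ → ℝ} {c r : ℝ}

/-- The solution operator acting on odd functions, truncated to the interval `(-ξ, ξ)` and written
in terms of the restrictions of odd functions to the positive half-line. -/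
noncomputable def truncated (ha : IsAdmissibleKernel a) (c r ξ : ℝ) : L2 →L[ℝ] L2 :=
  cut (Set.Ioo 0 ξ) measurableSet_Ioo ∘L solver ha.op c r ∘L oddPart ∘L
    cut (Set.Ioo 0 ξ) measurableSet_Ioo

lemma truncated_apply (ha : IsAdmissibleKernel a) (ξ : ℝ) (g : L2) :
    ha.truncated c r ξ g = cut (Set.Ioo 0 ξ) measurableSet_Ioo
      (solver ha.op c r (oddPart (cut (Set.Ioo 0 ξ) measurableSet_Ioo g))) := rfl

/-- The factors are selfadjoint, the outer cut-offs coincide, and `oddPart` commutes with the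
solver. -/
lemma inner_truncated (ha : IsAdmissibleKernel a) (hr0 : 0 ≤ r) (hr1 : r < 1) (ξ : ℝ) (g h : L2) :
    ⟪ha.truncated c r ξ g, h⟫ = ⟪g, ha.truncated c r ξ h⟫ := by
  rw [truncated_apply, truncated_apply, inner_cut,
    inner_solver ha.norm_op_le hr0 hr1 ha.inner_op, inner_oddPart, inner_cut,
    ha.oddPart_solver hr0 hr1]

lemma truncated_nonneg (ha : IsAdmissibleKernel a) (hc : 0 ≤ c) (hr0 : 0 ≤ r) (hr1 : r < 1)
    (ξ : ℝ) (g : L2) (hg : 0 ≤ g) : 0 ≤ ha.truncated c r ξ g := by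
  have h1 := ha.solver_mem_oddCone hc hr0 hr1
    (oddPart_mem_oddCone (cut_nonneg (measurableSet_Ioo (a := (0 : ℝ)) (b := ξ)) hg)
      (supportedOnPos_cut _ Set.Ioo_subset_Ioi_self g))
  rw [truncated_apply, ← Lp.coeFn_nonneg]
  filter_upwards [ae_nonneg_of_mem_oddCone h1, coeFn_cut (measurableSet_Ioo (a := (0 : ℝ)) (b := ξ))
    (solver ha.op c r (oddPart (cut (Set.Ioo 0 ξ) measurableSet_Ioo g)))] with x h2 h3
  rw [h3]
  exact Set.indicator_apply_nonneg fun hx => h2 hx.1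

lemma truncated_support (ha : IsAdmissibleKernel a) (ξ : ℝ) (g : L2) :
    ∀ᵐ x, x ∉ Set.Ioo 0 ξ → ha.truncated c r ξ g x = 0 := by
  rw [truncated_apply]
  filter_upwards [coeFn_cut (measurableSet_Ioo (a := (0 : ℝ)) (b := ξ))
    (solver ha.op c r (oddPart (cut (Set.Ioo 0 ξ) measurableSet_Ioo g)))] with x h3 hx
  rw [h3, Set.indicator_of_notMem hx]

lemma cut_eq_of_fixed (ha : IsAdmissibleKernel a) {ξ : ℝ} {g : L2}
    (hg : ha.truncated c r ξ g = g) : cut (Set.Ioo 0 ξ) measurableSet_Ioo g = g := by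
  conv_lhs => rw [← hg, truncated_apply, cut_cut]
  conv_rhs => rw [← hg, truncated_apply]
  simp only [Set.inter_self]

lemma supportedOnPos_of_fixed (ha : IsAdmissibleKernel a) {ξ : ℝ} {g : L2}
    (hg : ha.truncated c r ξ g = g) : SupportedOnPos g := by
  rw [← ha.cut_eq_of_fixed hg]
  exact supportedOnPos_cut _ Set.Ioo_subset_Ioi_self g

lemma truncated_strict (ha : IsAdmissibleKernel a) (hc : 0 < c) (hr0 : 0 ≤ r) (hr1 : r < 1)
    (ξ : ℝ) (g : L2) (hg : 0 ≤ g) (hTg : ha.truncated c r ξ g = g) (hg0 : g ≠ 0) :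
    ∀ᵐ x, x ∈ Set.Ioo 0 ξ → 0 < g x := by
  have h1 : cut (Set.Ioo 0 ξ) measurableSet_Ioo (solver ha.op c r (oddPart g)) = g := by
    conv_rhs => rw [← hTg, truncated_apply, ha.cut_eq_of_fixed hTg]
  have h2 := coeFn_cut (measurableSet_Ioo (a := (0 : ℝ)) (b := ξ))
    (solver ha.op c r (oddPart g))
  rw [h1] at h2
  filter_upwards [h2, ha.coeFn_solver (c := c) hr0 hr1 (oddPart g)] with x h3 h4 hx
  rw [h3, Set.indicator_of_mem hx, h4]
  exact ha.rep_oddPart_pos hc hr0 hr1 hg (ha.supportedOnPos_of_fixed hTg) hg0 hx.1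

lemma isCompactOperator_truncated (ha : IsAdmissibleKernel a) (ξ : ℝ) :
    IsCompactOperator (ha.truncated c r ξ) :=
  (ha.isCompactOperator_cut_op (measurableSet_Ioo (a := (0 : ℝ)) (b := ξ))
    (by simp)).comp_clm ((c • ∑' n : ℕ, (r • ha.op) ^ n) ∘L oddPart ∘L
      cut (Set.Ioo 0 ξ) measurableSet_Ioo)

lemma norm_oddPart_le (g : L2) : ‖oddPart g‖ ≤ 2 * ‖g‖ := by
  rw [oddPart_apply]
  refine (norm_sub_le _ _).trans_eq ?_
  rw [LinearIsometry.norm_map]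
  ring

/-- With D the cut-off to [s, t) and B the solver on odd parts, the difference is a cut-off of B D
plus D B applied to a cut-off. The sup bound on B makes D B of size √(t − s). -/
lemma norm_truncated_sub_le (ha : IsAdmissibleKernel a) (hc : 0 ≤ c) (hr0 : 0 ≤ r)
    (hr1 : r < 1) {s t : ℝ} (hs : 0 ≤ s) (hst : s ≤ t) :
    ‖ha.truncated c r t - ha.truncated c r s‖ ≤
      4 * (‖ha.vec‖ * (c + r * ‖solver ha.op c r‖)) * √(t - s) := by
  set M := ‖ha.vec‖ * (c + r * ‖solver ha.op c r‖) with hM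
  have hM0 : 0 ≤ M := by positivity
  let D := cut (Set.Ico s t) measurableSet_Ico
  let B := solver ha.op c r ∘L oddPart
  have hD : ∀ g, ‖D (B g)‖ ≤ 2 * M * √(t - s) * ‖g‖ := by
    intro g
    have h1 := ha.norm_cut_solver_le hc hr0 hr1 (measurableSet_Ico (a := s) (b := t))
      (by simp) (oddPart g)
    rw [Real.volume_real_Ico_of_le hst] at h1
    refine h1.trans ?_
    have := norm_oddPart_le g
    calc M * ‖oddPart g‖ * √(t - s) ≤ M * (2 * ‖g‖) * √(t - s) := by gcongr
      _ = _ := by ring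
  have hB : ∀ g h, ⟪B g, h⟫ = ⟪g, B h⟫ := fun g h => by
    simp only [B, ContinuousLinearMap.comp_apply]
    rw [inner_solver ha.norm_op_le hr0 hr1 ha.inner_op, inner_oddPart, ha.oddPart_solver hr0 hr1]
  -- The adjoint of the previous estimate, since B and D are selfadjoint.
  have hBD : ∀ g, ‖B (D g)‖ ≤ 2 * M * √(t - s) * ‖g‖ := by
    intro g
    have h1 : ‖B (D g)‖ ^ 2 ≤ (2 * M * √(t - s) * ‖g‖) * ‖B (D g)‖ := by
      calc ‖B (D g)‖ ^ 2 = ⟪g, D (B (B (D g)))⟫ := by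
            rw [← inner_cut, ← hB, real_inner_self_eq_norm_sq]
        _ ≤ ‖g‖ * ‖D (B (B (D g)))‖ := real_inner_le_norm _ _
        _ ≤ ‖g‖ * (2 * M * √(t - s) * ‖B (D g)‖) := by gcongr; exact hD _
        _ = _ := by ring
    rcases (norm_nonneg (B (D g))).eq_or_lt with h0 | h0
    · rw [← h0]
      positivity
    · rw [pow_two] at h1
      exact le_of_mul_le_mul_right h1 h0
  have hcut : ∀ g, cut (Set.Ioo 0 t) measurableSet_Ioo g =
      cut (Set.Ioo 0 s) measurableSet_Ioo g + D g := by
    intro g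
    apply Lp.ext
    filter_upwards [coeFn_cut (measurableSet_Ioo (a := (0 : ℝ)) (b := t)) g,
      coeFn_cut (measurableSet_Ioo (a := (0 : ℝ)) (b := s)) g,
      coeFn_cut (measurableSet_Ico (a := s) (b := t)) g,
      Lp.coeFn_add (cut (Set.Ioo 0 s) measurableSet_Ioo g) (D g), ae_ne 0] with x h1 h2 h3 h4 h5
    rw [h4, Pi.add_apply, h1, h2, h3]
    simp only [Set.indicator_apply, Set.mem_Ioo, Set.mem_Ico]
    rcases lt_or_gt_of_ne h5 with h | h
    · rw [if_neg (by intro h'; linarith [h'.1]), if_neg (by intro h'; linarith [h'.1]),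
        if_neg (by intro h'; linarith [h'.1]), add_zero]
    · by_cases h' : x < s
      · rw [if_pos ⟨h, h'.trans_le hst⟩, if_pos ⟨h, h'⟩, if_neg (by intro h''; linarith [h''.1]),
          add_zero]
      · rw [not_lt] at h'
        rw [if_neg (c := 0 < x ∧ x < s) (by intro h''; linarith [h''.2]), zero_add]
        by_cases h6 : x < t
        · rw [if_pos ⟨h, h6⟩, if_pos ⟨h', h6⟩]
        · rw [if_neg (by intro h''; exact h6 h''.2), if_neg (by intro h''; exact h6 h''.2)]
  refine ContinuousLinearMap.opNorm_le_bound _ (by positivity) fun g => ?_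
  have h1 : (ha.truncated c r t - ha.truncated c r s) g =
      cut (Set.Ioo 0 t) measurableSet_Ioo (B (D g)) +
        D (B (cut (Set.Ioo 0 s) measurableSet_Ioo g)) := by
    rw [sub_apply, truncated_apply, truncated_apply]
    change cut (Set.Ioo 0 t) measurableSet_Ioo (B (cut (Set.Ioo 0 t) measurableSet_Ioo g)) -
      cut (Set.Ioo 0 s) measurableSet_Ioo (B (cut (Set.Ioo 0 s) measurableSet_Ioo g)) = _
    rw [hcut g, map_add, map_add, hcut (B (cut (Set.Ioo 0 s) measurableSet_Ioo g))]
    abel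
  rw [h1]
  calc _ ≤ ‖B (D g)‖ + ‖D (B (cut (Set.Ioo 0 s) measurableSet_Ioo g))‖ :=
        (norm_add_le _ _).trans (by gcongr; exact norm_cut_le _ _)
    _ ≤ 2 * M * √(t - s) * ‖g‖ + 2 * M * √(t - s) * ‖g‖ := by
        refine add_le_add (hBD g) ((hD _).trans ?_)
        gcongr
        exact norm_cut_le _ _
    _ = _ := by ring

lemma continuousOn_norm_truncated (ha : IsAdmissibleKernel a) (hc : 0 ≤ c) (hr0 : 0 ≤ r)
    (hr1 : r < 1) : ContinuousOn (fun ξ => ‖ha.truncated c r ξ‖) (Set.Ici 0) := by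
  set M := ‖ha.vec‖ * (c + r * ‖solver ha.op c r‖) with hM
  have hbound : ∀ s ∈ Set.Ici (0 : ℝ), ∀ t ∈ Set.Ici (0 : ℝ),
      ‖ha.truncated c r t - ha.truncated c r s‖ ≤ 4 * M * √|t - s| := by
    intro s hs t ht
    rcases le_total s t with h | h
    · rw [abs_of_nonneg (sub_nonneg.2 h)]
      exact ha.norm_truncated_sub_le hc hr0 hr1 hs h
    · rw [abs_sub_comm, abs_of_nonneg (sub_nonneg.2 h), norm_sub_rev]
      exact ha.norm_truncated_sub_le hc hr0 hr1 ht h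
  refine ContinuousOn.norm fun s hs => ?_
  rw [ContinuousWithinAt, tendsto_iff_norm_sub_tendsto_zero]
  have hlim : Tendsto (fun t => 4 * M * √|t - s|) (𝓝[Set.Ici 0] s) (𝓝 0) := by
    have : Continuous fun t => 4 * M * √|t - s| := by fun_prop
    have h := this.tendsto s
    simp only [sub_self, abs_zero, Real.sqrt_zero, mul_zero] at h
    exact h.mono_left nhdsWithin_le_nhds
  refine squeeze_zero' (Eventually.of_forall fun _ => norm_nonneg _) ?_ hlim
  filter_upwards [self_mem_nhdsWithin] with t ht using hbound s hs t ht

lemma norm_truncated_zero (ha : IsAdmissibleKernel a) : ‖ha.truncated c r 0‖ = 0 := by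
  rw [norm_eq_zero]
  ext1 g
  apply Lp.ext
  filter_upwards [ha.truncated_support (c := c) (r := r) 0 g,
    Lp.coeFn_zero ℝ 2 (volume : Measure ℝ)] with x h1 h2
  rw [h1 (by simp), zero_apply, h2]
  rfl

/-- The indicator function of the interval `(0, L)`. -/
noncomputable def box (L : ℝ) : L2 :=
  indicatorConstLp 2 (measurableSet_Ioo (a := (0 : ℝ)) (b := L)) (by simp) (1 : ℝ)

lemma norm_box {L : ℝ} (hL : 0 ≤ L) : ‖box L‖ = √L := by
  rw [box, norm_indicatorConstLp (by norm_num) (by norm_num), Real.volume_real_Ioo_of_le hL,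
    Real.sqrt_eq_rpow]
  norm_num

lemma coeFn_box (L : ℝ) : box L =ᵐ[volume] (Set.Ioo 0 L).indicator fun _ => (1 : ℝ) :=
  indicatorConstLp_coeFn

/-- An interval of length L overlaps its translate by t in length at least L − |t|. -/
lemma norm_shift_box_sub_sq_le {L : ℝ} (hL : 0 ≤ L) (t : ℝ) :
    ‖shift t (box L) - box L‖ ^ 2 ≤ 2 * |t| := by
  have h1 : L - |t| ≤ ⟪shift t (box L), box L⟫ := by
    have h2 : ⟪shift t (box L), box L⟫ = volume.real (Set.Ioo t (L + t) ∩ Set.Ioo 0 L) := by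
      rw [inner_eq_integral, ← integral_indicator_one
        (measurableSet_Ioo.inter measurableSet_Ioo)]
      apply integral_congr_ae
      filter_upwards [coeFn_shift t (box L), coeFn_box L, ae_sub (coeFn_box L) t] with x h1 h2 h3
      rw [h1, h2, h3]
      simp only [Set.indicator_apply, Set.mem_inter_iff, Set.mem_Ioo, sub_pos,
        sub_lt_iff_lt_add, Pi.one_apply]
      by_cases h4 : t < x ∧ x < L + t <;> by_cases h5 : 0 < x ∧ x < L <;> simp [h4, h5]
    rw [h2, Set.Ioo_inter_Ioo, Real.volume_real_Ioo]
    refine le_trans ?_ (le_max_left _ _)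
    have h3 : t ⊔ 0 ≤ (t + |t|) / 2 := sup_le (by linarith [le_abs_self t])
      (by linarith [neg_abs_le t])
    have h4 : L + (t - |t|) / 2 ≤ (L + t) ⊓ L := le_inf (by linarith [neg_abs_le t])
      (by linarith [le_abs_self t])
    linarith
  rw [norm_sub_sq_real, LinearIsometry.norm_map, norm_box hL, Real.sq_sqrt hL]
  linarith

/-- Wide boxes are approximately fixed by the convolution, because a has integral one. For each t
the relative error tends to 0, and 2 |a| dominates. -/
lemma tendsto_norm_op_box_sub (ha : IsAdmissibleKernel a) :
    Tendsto (fun n : ℕ => ‖ha.op (box n) - box n‖ / √n) atTop (𝓝 0) := by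
  have h1 : ∀ n : ℕ, ‖ha.op (box n) - box n‖ / √n ≤
      ∫ t, |a t| * (‖shift t (box n) - box n‖ / √n) := by
    intro n
    have h2 : ha.op (box n) - box n = ∫ t, a t • (shift t (box n) - box n) := by
      simp_rw [smul_sub]
      rw [integral_sub (integrable_smul_shift ha.integrable _) (ha.integrable.smul_const _),
        integral_smul_const, ha.integral_eq_one, one_smul]
      rfl
    rw [h2]
    simp_rw [← mul_div_assoc]
    rw [integral_div]
    gcongr
    refine (norm_integral_le_integral_norm _).trans_eq ?_
    simp_rw [norm_smul, Real.norm_eq_abs]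
  have h3 : Tendsto (fun n : ℕ => ∫ t, |a t| * (‖shift t (box n) - box n‖ / √n)) atTop
      (𝓝 (∫ _ : ℝ, (0 : ℝ))) := by
    refine tendsto_integral_of_dominated_convergence (fun t => |a t| * 2) (fun n => ?_)
      (ha.integrable.abs.mul_const 2) (fun n => Eventually.of_forall fun t => ?_)
      (Eventually.of_forall fun t => ?_)
    · exact ha.integrable.abs.1.mul
        (((continuous_shift (box n)).sub continuous_const).norm.div_const _).aestronglyMeasurable
    · rw [norm_mul, norm_div, Real.norm_eq_abs, abs_abs, norm_norm,
        Real.norm_of_nonneg (Real.sqrt_nonneg _)]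
      gcongr
      refine div_le_of_le_mul₀ (Real.sqrt_nonneg _) zero_le_two ?_
      refine (norm_sub_le _ _).trans_eq ?_
      rw [LinearIsometry.norm_map, norm_box (Nat.cast_nonneg n)]
      ring
    · have h4 : Tendsto (fun n : ℕ => √(2 * |t| / n)) atTop (𝓝 0) := by
        have := (Real.continuous_sqrt.tendsto 0).comp
          (tendsto_const_div_atTop_nhds_zero_nat (2 * |t|))
        simpa [Function.comp_def] using this
      have h5 : Tendsto (fun n : ℕ => ‖shift t (box n) - box n‖ / √n) atTop (𝓝 0) := by
        refine squeeze_zero (fun n => by positivity) (fun n => ?_) h4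
        rw [Real.sqrt_div (by positivity)]
        gcongr
        exact Real.le_sqrt_of_sq_le (norm_shift_box_sub_sq_le (Nat.cast_nonneg n) t)
      simpa using h5.const_mul |a t|
  rw [integral_zero] at h3
  exact squeeze_zero (fun n => by positivity) h1 h3

lemma exists_one_lt_norm_truncated (ha : IsAdmissibleKernel a) (hc : 0 < c) (hr0 : 0 ≤ r)
    (hr1 : r < 1) (hcr : 1 < c + r) : ∃ L : ℝ, 0 < L ∧ 1 < ‖ha.truncated c r L‖ := by
  -- The factor by which the solver would act on constants: c times the geometric series in r. It
  -- exceeds 1 exactly because c + r > 1.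
  set m := c / (1 - r) with hm
  have hr1' : 0 < 1 - r := sub_pos.2 hr1
  have hm1 : 1 < m := by
    rw [hm, lt_div_iff₀ hr1']
    linarith
  have hmeq : m = c + r * m := by
    rw [hm]
    field_simp
    ring
  have hlim : Tendsto (fun n : ℕ => m / (1 - r) * (2 * (‖ha.op (box n) - box n‖ / √n))) atTop
      (𝓝 0) := by
    simpa using (ha.tendsto_norm_op_box_sub.const_mul 2).const_mul (m / (1 - r))
  obtain ⟨n, hn, hn0⟩ := ((hlim.eventually_lt_const (sub_pos.2 hm1)).and
    (eventually_gt_atTop 0)).exists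
  have hn0 : (0 : ℝ) < n := Nat.cast_pos.2 hn0
  refine ⟨n, hn0, ?_⟩
  set p := box n with hp
  have hp0 : 0 < ‖p‖ := by
    rw [hp, norm_box hn0.le]
    exact Real.sqrt_pos.2 hn0
  have hcutp : cut (Set.Ioo 0 (n : ℝ)) measurableSet_Ioo p = p := by
    apply Lp.ext
    filter_upwards [coeFn_cut (measurableSet_Ioo (a := (0 : ℝ)) (b := n)) p, coeFn_box n]
      with x h1 h2
    rw [h1]
    by_cases hx : x ∈ Set.Ioo 0 (n : ℝ)
    · rw [Set.indicator_of_mem hx]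
    · rw [Set.indicator_of_notMem hx, h2, Set.indicator_of_notMem hx]
  have hcutg : cut (Set.Ioo 0 (n : ℝ)) measurableSet_Ioo (oddPart p) = p := by
    have hs : SupportedOnPos p := by
      rw [← hcutp]
      exact supportedOnPos_cut _ Set.Ioo_subset_Ioi_self p
    conv_rhs => rw [← hcutp]
    apply Lp.ext
    filter_upwards [coeFn_cut (measurableSet_Ioo (a := (0 : ℝ)) (b := n)) p,
      coeFn_cut (measurableSet_Ioo (a := (0 : ℝ)) (b := n)) (oddPart p),
      coeFn_oddPart_of_supportedOnPos hs] with x h1 h2 h3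
    rw [h1, h2]
    by_cases hx : x ∈ Set.Ioo 0 (n : ℝ)
    · rw [Set.indicator_of_mem hx, Set.indicator_of_mem hx, h3 hx.1]
    · rw [Set.indicator_of_notMem hx, Set.indicator_of_notMem hx]
  set g := oddPart p with hg
  set d := solver ha.op c r g - m • g with hd
  -- As m = c + r m, the error d solves the linear equation driven by A g − g alone, so it is small
  -- with that term.
  have hd1 : d = r • ha.op d + m • (ha.op g - g) := by
    have h1 : solver ha.op c r g = ha.op (c • g + r • (d + m • g)) := by
      rw [hd, sub_add_cancel]
      exact solver_eq ha.norm_op_le hr0 hr1 g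
    have h2 : c • g + r • (d + m • g) = r • d + m • g := by
      conv_rhs => rw [hmeq]
      module
    rw [h2, map_add, map_smul, map_smul] at h1
    conv_lhs => rw [hd, h1]
    module
  have hAg : ‖ha.op g - g‖ ≤ 2 * ‖ha.op p - p‖ := by
    have : ha.op g - g = oddPart (ha.op p - p) := by
      rw [hg, map_sub, oddPart_apply (ha.op p), ha.reflect_op, oddPart_apply p, map_sub]
    rw [this]
    exact norm_oddPart_le _
  have hd2 : ‖d‖ ≤ m / (1 - r) * (2 * ‖ha.op p - p‖) := by
    have h1 : ‖d‖ ≤ r * ‖d‖ + m * (2 * ‖ha.op p - p‖) := by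
      conv_lhs => rw [hd1]
      refine (norm_add_le _ _).trans ?_
      rw [norm_smul, norm_smul, Real.norm_of_nonneg hr0, Real.norm_of_nonneg (by linarith)]
      gcongr
      exact (ha.op.le_opNorm d).trans (by nlinarith [ha.norm_op_le, norm_nonneg d])
    rw [div_mul_eq_mul_div, le_div_iff₀ hr1']
    linarith
  have hT : ha.truncated c r n p = cut (Set.Ioo 0 (n : ℝ)) measurableSet_Ioo d + m • p := by
    rw [truncated_apply, hcutp, ← hg, hd, map_sub, map_smul, hcutg, sub_add_cancel]
  have h3 : m * ‖p‖ ≤ ‖ha.truncated c r n‖ * ‖p‖ + ‖d‖ := by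
    calc m * ‖p‖ = ‖ha.truncated c r n p - cut (Set.Ioo 0 (n : ℝ)) measurableSet_Ioo d‖ := by
          rw [hT, add_sub_cancel_left, norm_smul, Real.norm_of_nonneg (by linarith)]
      _ ≤ _ := (norm_sub_le _ _).trans
          (add_le_add (ContinuousLinearMap.le_opNorm _ _) (norm_cut_le _ _))
  have h4 : ‖d‖ < (m - 1) * ‖p‖ := by
    refine hd2.trans_lt ?_
    have h5 : √(n : ℝ) = ‖p‖ := (norm_box hn0.le).symm
    rw [h5, ← mul_div_assoc, ← mul_div_assoc, div_lt_iff₀ hp0] at hn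
    exact hn
  have h5 : 1 * ‖p‖ < ‖ha.truncated c r n‖ * ‖p‖ := by linarith
  exact lt_of_mul_lt_mul_right h5 hp0.le

/-- The intermediate value theorem selects an interval on which the norm is exactly 1; there the
Perron–Frobenius argument applies. -/
lemma exists_truncated_fixed (ha : IsAdmissibleKernel a) (hc : 0 < c) (hr0 : 0 ≤ r)
    (hr1 : r < 1) (hcr : 1 < c + r) :
    ∃ ξ : ℝ, 0 < ξ ∧ ∃ p : L2, 0 ≤ p ∧ p ≠ 0 ∧ ha.truncated c r ξ p = p := by
  obtain ⟨L, hL, hL1⟩ := ha.exists_one_lt_norm_truncated hc hr0 hr1 hcr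
  have hcont : ContinuousOn (fun ξ => ‖ha.truncated c r ξ‖) (Set.Icc 0 L) :=
    (ha.continuousOn_norm_truncated hc.le hr0 hr1).mono Set.Icc_subset_Ici_self
  obtain ⟨ξ, hξ, hξ1⟩ := intermediate_value_Icc hL.le hcont
    (show (1 : ℝ) ∈ Set.Icc _ _ from ⟨by rw [norm_truncated_zero]; exact zero_le_one, hL1.le⟩)
  have hξ1 : ‖ha.truncated c r ξ‖ = 1 := hξ1
  have hξ0 : ξ ≠ 0 := by
    rintro rfl
    rw [norm_truncated_zero] at hξ1
    exact zero_ne_one hξ1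
  exact ⟨ξ, lt_of_le_of_ne hξ.1 hξ0.symm, exists_nonneg_fixed (ha.inner_truncated hr0 hr1 ξ)
    (ha.truncated_nonneg hc.le hr0 hr1 ξ) (ha.isCompactOperator_truncated ξ) hξ1⟩

end IsAdmissibleKernel

/-! ### Primitives of odd functions and continuous representatives. -/

namespace L2

lemma intervalIntegrable (g : L2) (s t : ℝ) : IntervalIntegrable g volume s t := by
  rw [intervalIntegrable_iff, Set.uIoc]
  exact ((Lp.memLp g).restrict _).integrable (by norm_num)

/-- The primitive `x ↦ ∫_x^ξ g`. -/
noncomputable def primitive (g : L2) (ξ x : ℝ) : ℝ := ∫ y in x..ξ, g y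

lemma primitive_sub (g : L2) (ξ x y : ℝ) :
    primitive g ξ x - primitive g ξ y = ∫ z in x..y, g z := by
  unfold primitive
  rw [← intervalIntegral.integral_add_adjacent_intervals (intervalIntegrable g x y)
    (intervalIntegrable g y ξ), add_sub_cancel_right]

lemma continuous_primitive (g : L2) (ξ : ℝ) : Continuous (primitive g ξ) := by
  have h := (intervalIntegral.continuous_primitive (fun s t => intervalIntegrable g s t) ξ).neg
  refine h.congr fun x => ?_
  rw [primitive, intervalIntegral.integral_symm]
  rfl

lemma integral_neg_self_eq_zero {g : L2} (hodd : ∀ᵐ x, g (-x) = -g x) (x : ℝ) :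
    ∫ y in (-x)..x, g y = 0 := by
  have h1 : ∫ y in (-x)..x, g (-y) = ∫ y in (-x)..x, g y := by
    rw [intervalIntegral.integral_comp_neg (fun y => g y), neg_neg]
  have h2 : ∫ y in (-x)..x, g (-y) = -∫ y in (-x)..x, g y := by
    rw [← intervalIntegral.integral_neg]
    exact intervalIntegral.integral_congr_ae (hodd.mono fun y hy _ => hy)
  linarith

lemma primitive_neg {g : L2} (hodd : ∀ᵐ x, g (-x) = -g x) (ξ x : ℝ) :
    primitive g ξ (-x) = primitive g ξ x := by
  rw [← sub_eq_zero, primitive_sub, integral_neg_self_eq_zero hodd]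

lemma primitive_abs {g : L2} (hodd : ∀ᵐ x, g (-x) = -g x) (ξ x : ℝ) :
    primitive g ξ |x| = primitive g ξ x := by
  rcases abs_choice x with h | h <;> rw [h]
  exact primitive_neg hodd ξ x

lemma primitive_eq_zero {g : L2} {ξ : ℝ} (hodd : ∀ᵐ x, g (-x) = -g x)
    (hsupp : ∀ᵐ x, ξ ≤ |x| → g x = 0) {x : ℝ} (hx : ξ ≤ |x|) : primitive g ξ x = 0 := by
  rw [← primitive_abs hodd, primitive, intervalIntegral.integral_symm, neg_eq_zero]
  refine intervalIntegral.integral_zero_ae (hsupp.mono fun y hy hy' => hy ?_)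
  rw [Set.uIoc_of_le hx] at hy'
  exact hy'.1.le.trans (le_abs_self y)

lemma memLp_primitive {g : L2} {ξ : ℝ} (hodd : ∀ᵐ x, g (-x) = -g x)
    (hsupp : ∀ᵐ x, ξ ≤ |x| → g x = 0) : MemLp (primitive g ξ) 2 := by
  refine (continuous_primitive g ξ).memLp_of_hasCompactSupport
    (HasCompactSupport.intro (isCompact_Icc (a := -ξ) (b := ξ)) fun x hx => ?_)
  refine primitive_eq_zero hodd hsupp ?_
  by_contra h
  rw [not_le, abs_lt] at h
  exact hx ⟨h.1.le, h.2.le⟩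

lemma primitive_nonneg {g : L2} {ξ : ℝ} (hodd : ∀ᵐ x, g (-x) = -g x)
    (hsupp : ∀ᵐ x, ξ ≤ |x| → g x = 0) (hnn : ∀ᵐ x, 0 < x → 0 ≤ g x) (x : ℝ) :
    0 ≤ primitive g ξ x := by
  rcases le_total ξ |x| with h | h
  · rw [primitive_eq_zero hodd hsupp h]
  · rw [← primitive_abs hodd, primitive]
    refine intervalIntegral.integral_nonneg_of_ae_restrict h ?_
    rw [EventuallyLE, ae_restrict_iff' measurableSet_Icc]
    filter_upwards [hnn, ae_ne 0] with y h1 h2 h3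
    exact h1 (lt_of_le_of_ne ((abs_nonneg x).trans h3.1) h2.symm)

lemma shift_sub_eq_average {u g : L2} {f : ℝ → ℝ} (hu : u =ᵐ[volume] f)
    (hf : ∀ x y, f x - f y = ∫ z in x..y, g z) {s : ℝ} (hs : 0 < s) :
    shift s u - u = average s g := by
  apply Lp.ext
  filter_upwards [Lp.coeFn_sub (shift s u) u, coeFn_shift s u, ae_sub hu s, hu,
    coeFn_average s hs.le g] with x h1 h2 h3 h4 h5
  rw [h1, Pi.sub_apply, h2, h3, h4, hf, h5]

/-- For each fixed step both sides are continuous in the base point, so equality a.e. is equality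
everywhere. V plays the role of −f'. -/
lemma sub_eq_integral_of_average {u V : L2} {f : ℝ → ℝ} (hu : u =ᵐ[volume] f)
    (hf : Continuous f) (h : ∀ s : ℝ, 0 < s → shift s u - u = average s V) (x y : ℝ) :
    f x - f y = ∫ z in x..y, V z := by
  have hlt : ∀ x y, x < y → f x - f y = ∫ z in x..y, V z := by
    intro x y hxy
    have hs : 0 < y - x := sub_pos.2 hxy
    have hc1 : Continuous fun z => f (z - (y - x)) - f z := by fun_prop
    have hc2 : Continuous fun z => ∫ t in (z - (y - x))..z, V t := by
      have h1 := continuous_primitive V 0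
      refine ((h1.comp (continuous_sub_right (y - x))).sub h1).congr fun z => ?_
      exact primitive_sub V 0 _ _
    have hae : (fun z => f (z - (y - x)) - f z) =ᵐ[volume]
        fun z => ∫ t in (z - (y - x))..z, V t := by
      filter_upwards [Lp.coeFn_sub (shift (y - x) u) u, coeFn_shift (y - x) u,
        ae_sub hu (y - x), hu, coeFn_average (y - x) hs.le V] with z h1 h2 h3 h4 h5
      rw [← h5, ← h _ hs, h1, Pi.sub_apply, h2, h3, h4]
    have := congr_fun ((hc1.ae_eq_iff_eq volume hc2).1 hae) y
    simpa using this
  rcases lt_trichotomy x y with hxy | rfl | hxy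
  · exact hlt x y hxy
  · simp
  · rw [intervalIntegral.integral_symm, ← hlt y x hxy, neg_sub]

lemma mem_unimodalCone {u : L2} {f : ℝ → ℝ} (hu : u =ᵐ[volume] f)
    (heven : ∀ x, f (-x) = f x) (hanti : AntitoneOn f (Set.Ioi 0)) (hnn : ∀ x, 0 ≤ f x) :
    (u : ℝ → ℝ) ∈ unimodalCone := by
  refine ⟨Lp.memLp u, ?_, ?_⟩
  · filter_upwards [hu, ae_neg hu] with x h1 h2
    rw [h1, h2, heven]
  · have h1 : ∀ᵐ p : ℝ × ℝ, u p.1 = f p.1 := Measure.quasiMeasurePreserving_fst.ae hu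
    have h2 : ∀ᵐ p : ℝ × ℝ, u p.2 = f p.2 := Measure.quasiMeasurePreserving_snd.ae hu
    filter_upwards [h1, h2] with p h1 h2 h3 h4
    rw [h1, h2]
    exact ⟨hanti h3 (h3.trans h4) h4.le, hnn _⟩

end L2

/-- This splitting makes the equation linear in u and its excess over θ. -/
lemma bilinear_eq (ζ θ η r : ℝ) : bilinear ζ θ η r = ζ * r + η * max (r - θ) 0 := by
  unfold bilinear
  split_ifs with h
  · rw [max_eq_right (sub_nonpos.2 h)]
    ring
  · rw [max_eq_left (sub_nonneg.2 (not_le.1 h).le)]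
    ring

/-! ### Existence of a solution. -/

namespace IsAdmissibleKernel

open L2

variable {a : ℝ → ℝ} {c r : ℝ}

lemma convolution_eq_of_ae (ha : IsAdmissibleKernel a) {f : ℝ → ℝ} {g : L2}
    (h : f =ᵐ[volume] g) (x : ℝ) :
    convolution a f (ContinuousLinearMap.mul ℝ ℝ) volume x = ⟪shift x ha.vec, g⟫ := by
  rw [← ha.convolution_eq]
  apply integral_congr_ae
  filter_upwards [ae_const_sub h x] with t ht
  rw [ht]

lemma shift_solver_sub (ha : IsAdmissibleKernel a) (hr0 : 0 ≤ r) (hr1 : r < 1) {w g : L2} {s : ℝ}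
    (h : shift s w - w = average s g) :
    shift s (solver ha.op c r w) - solver ha.op c r w = average s (solver ha.op c r g) := by
  rw [ha.shift_solver hr0 hr1, ← map_sub, h,
    map_average fun t g => (ha.shift_solver hr0 hr1 t g).symm]

lemma rep_neg (ha : IsAdmissibleKernel a) (hr0 : 0 ≤ r) (hr1 : r < 1) {w : L2}
    (hw : reflect w = w) (x : ℝ) : ha.rep c r w (-x) = ha.rep c r w x := by
  have h := ha.coeFn_solver (c := c) hr0 hr1 w
  have hae : (fun x => ha.rep c r w (-x)) =ᵐ[volume] ha.rep c r w := by
    have h1 := coeFn_reflect (solver ha.op c r w)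
    rw [ha.reflect_solver hr0 hr1, hw] at h1
    filter_upwards [h, h1, ae_neg h] with x h2 h3 h4
    rw [← h2, ← h4, h3]
  exact congr_fun (((ha.continuous_rep w).comp continuous_neg).ae_eq_iff_eq volume
    (ha.continuous_rep w) |>.1 hae) x

/-- A fixed point of the truncated operator gives rise to a function `u` in the image of the
solution operator whose part above a positive level is mapped to `u`. -/
lemma exists_unimodal_profile (ha : IsAdmissibleKernel a) (hc : 0 < c) (hr0 : 0 ≤ r)
    (hr1 : r < 1) (hcr : 1 < c + r) :
    ∃ (w : L2) (κ : ℝ), 0 < κ ∧ w ≠ 0 ∧ 0 ≤ w ∧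
      (∀ x, ha.rep c r w (-x) = ha.rep c r w x) ∧
      AntitoneOn (ha.rep c r w) (Set.Ioi 0) ∧
      w =ᵐ[volume] fun x => max (ha.rep c r w x - κ) 0 := by
  obtain ⟨ξ, hξ, p, hp, hp0, hTp⟩ := ha.exists_truncated_fixed hc hr0 hr1 hcr
  have hps := ha.supportedOnPos_of_fixed hTp
  set g := oddPart p with hg
  set V := solver ha.op c r g with hV
  have hgC : g ∈ oddCone := oddPart_mem_oddCone hp hps
  have hVC : V ∈ oddCone := ha.solver_mem_oddCone hc.le hr0 hr1 hgC
  have hodd := ae_odd_of_mem_oddCone hgC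
  have hgnn := ae_nonneg_of_mem_oddCone hgC
  have hVnn := ae_nonneg_of_mem_oddCone hVC
  have hcut : cut (Set.Ioo 0 ξ) measurableSet_Ioo V = p := by
    conv_rhs => rw [← hTp, truncated_apply, ha.cut_eq_of_fixed hTp]
  have hpV : ∀ᵐ x, 0 < x → g x = (Set.Ioo 0 ξ).indicator V x := by
    have h1 := coeFn_cut (measurableSet_Ioo (a := (0 : ℝ)) (b := ξ)) V
    rw [hcut] at h1
    filter_upwards [h1, coeFn_oddPart_of_supportedOnPos hps] with x h2 h3 hx
    rw [h3 hx, h2]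
  have hsupp : ∀ᵐ x, ξ ≤ |x| → g x = 0 := by
    have h1 : ∀ᵐ x, 0 < x → ξ ≤ x → g x = 0 := by
      filter_upwards [hpV] with x hx h0 h1
      rw [hx h0, Set.indicator_of_notMem fun h => not_lt.2 h1 h.2]
    filter_upwards [h1, ae_neg h1, hodd, ae_ne 0] with x h1 h2 h3 h4 h5
    rcases lt_or_gt_of_ne h4 with h | h
    · rw [abs_of_neg h] at h5
      rw [← neg_eq_zero, ← h3]
      exact h2 (neg_pos.2 h) h5
    · rw [abs_of_pos h] at h5
      exact h1 h h5
  have hmem := memLp_primitive hodd hsupp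
  set w : L2 := hmem.toLp _ with hw
  have hwf : w =ᵐ[volume] primitive g ξ := hmem.coeFn_toLp
  have hwavg : ∀ s : ℝ, 0 < s → shift s w - w = average s g := fun s hs =>
    shift_sub_eq_average hwf (primitive_sub g ξ) hs
  have hw0 : w ≠ 0 := by
    intro h
    have hg0 : g = 0 := eq_zero_of_average_eq_zero fun s hs => by
      rw [← hwavg s hs, h, map_zero, sub_zero]
    apply hp0
    rw [← hcut, hV, hg0, map_zero, map_zero]
  have hwnn : 0 ≤ w := by
    rw [← Lp.coeFn_nonneg]
    filter_upwards [hwf] with x hx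
    rw [hx]
    exact primitive_nonneg hodd hsupp hgnn x
  have hweven : reflect w = w := by
    apply Lp.ext
    filter_upwards [coeFn_reflect w, hwf, ae_neg hwf] with x h1 h2 h3
    rw [h1, h2, h3, primitive_neg hodd]
  have hrep : ∀ x y, ha.rep c r w x - ha.rep c r w y = ∫ z in x..y, V z :=
    sub_eq_integral_of_average (ha.coeFn_solver hr0 hr1 w) (ha.continuous_rep w)
      fun s hs => ha.shift_solver_sub hr0 hr1 (hwavg s hs)
  have heven : ∀ x, ha.rep c r w (-x) = ha.rep c r w x := ha.rep_neg hr0 hr1 hweven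
  have hanti : AntitoneOn (ha.rep c r w) (Set.Ioi 0) := by
    intro x hx y hy hxy
    rw [← sub_nonneg, hrep]
    refine intervalIntegral.integral_nonneg_of_ae_restrict hxy ?_
    rw [EventuallyLE, ae_restrict_iff' measurableSet_Icc]
    filter_upwards [hVnn] with z h1 h2
    exact h1 (lt_of_lt_of_le hx h2.1)
  -- The level κ is the value of the profile at the edge ξ.
  refine ⟨w, ha.rep c r w ξ, ha.rep_pos_of_nonneg hc hr0 hr1 hwnn hw0 ξ, hw0, hwnn, heven,
    hanti, ?_⟩
  filter_upwards [hwf] with x hx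
  rw [hx, ← primitive_abs hodd]
  have habs : ha.rep c r w x = ha.rep c r w |x| := by
    rcases abs_choice x with h | h <;> rw [h]
    exact (heven x).symm
  rw [habs]
  -- Outside the edge the profile is at most κ by monotonicity. Inside, g and V agree, so w and the
  -- profile have equal increments.
  rcases le_total ξ |x| with h | h
  · rw [primitive_eq_zero hodd hsupp (by rwa [abs_abs]), max_eq_right]
    exact sub_nonpos.2 (hanti hξ (hξ.trans_le h) h)
  · have h1 : ha.rep c r w |x| - ha.rep c r w ξ = primitive g ξ |x| := by
      rw [hrep, primitive]
      refine intervalIntegral.integral_congr_ae ?_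
      filter_upwards [hpV, ae_ne ξ] with z h2 h3 h4
      rw [Set.uIoc_of_le h] at h4
      have h5 : 0 < z := (abs_nonneg x).trans_lt h4.1
      rw [h2 h5, Set.indicator_of_mem (show z ∈ Set.Ioo 0 ξ from ⟨h5, lt_of_le_of_ne h4.2 h3⟩)]
    rw [h1, max_eq_left]
    exact primitive_nonneg hodd hsupp hgnn _

lemma exists_solution (ha : IsAdmissibleKernel a) {ζ θ η σ : ℝ} (hζ : 0 ≤ ζ) (hθ : 0 < θ)
    (hη : 0 < η) (hσ : σ ∈ Set.Ioo ζ (ζ + η)) :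
    ∃ u : L2, u ≠ 0 ∧ (u : ℝ → ℝ) ∈ unimodalCone ∧ SolvesEigenproblem a ζ θ η σ u := by
  have hσ0 : 0 < σ := hζ.trans_lt hσ.1
  have hc : 0 < η / σ := div_pos hη hσ0
  have hr0 : 0 ≤ ζ / σ := div_nonneg hζ hσ0.le
  have hr1 : ζ / σ < 1 := (div_lt_one hσ0).2 hσ.1
  have hcr : 1 < η / σ + ζ / σ := by
    rw [← add_div, one_lt_div hσ0]
    linarith [hσ.2]
  obtain ⟨w, κ, hκ, hw0, hwnn, heven, hanti, hwmax⟩ := ha.exists_unimodal_profile hc hr0 hr1 hcr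
  set f := ha.rep (η / σ) (ζ / σ) w with hf
  set v := solver ha.op (η / σ) (ζ / σ) w with hv
  have hvf : v =ᵐ[volume] f := ha.coeFn_solver hr0 hr1 w
  have hpos : ∀ x, 0 < f x := ha.rep_pos_of_nonneg hc hr0 hr1 hwnn hw0
  -- Taking the excess over a level is positively homogeneous, so scaling moves the level κ to θ.
  set t := θ / κ with ht
  have ht0 : 0 < t := div_pos hθ hκ
  have htκ : t * κ = θ := div_mul_cancel₀ _ hκ.ne'
  have huf : ((t • v : L2) : ℝ → ℝ) =ᵐ[volume] fun x => t * f x := by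
    filter_upwards [Lp.coeFn_smul t v, hvf] with x h1 h2
    rw [h1, Pi.smul_apply, h2, smul_eq_mul]
  refine ⟨t • v, fun h => ?_, mem_unimodalCone huf (fun x => by rw [heven])
    (fun x hx y hy hxy => mul_le_mul_of_nonneg_left (hanti hx hy hxy) ht0.le)
    (fun x => (mul_pos ht0 (hpos x)).le), ?_⟩
  · have h1 : ∀ᵐ _ : ℝ, False := by
      filter_upwards [huf, Lp.coeFn_zero ℝ 2 (volume : Measure ℝ)] with x h1 h2
      rw [h, h2] at h1
      exact (mul_pos ht0 (hpos x)).ne h1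
    obtain ⟨x, hx⟩ := h1.exists
    exact hx
  · have hG : (fun y => bilinear ζ θ η ((t • v : L2) y)) =ᵐ[volume]
        ((σ * t) • ((η / σ) • w + (ζ / σ) • v) : L2) := by
      filter_upwards [huf, hvf, hwmax,
        Lp.coeFn_smul (σ * t) ((η / σ) • w + (ζ / σ) • v),
        Lp.coeFn_add ((η / σ) • w) ((ζ / σ) • v),
        Lp.coeFn_smul (η / σ) w, Lp.coeFn_smul (ζ / σ) v] with x h1 h2 h3 h4 h5 h6 h7
      rw [h4, Pi.smul_apply, h5, Pi.add_apply, h6, h7, Pi.smul_apply, Pi.smul_apply, h1,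
        bilinear_eq, h3, h2, ← htκ, ← mul_sub]
      have h8 : max (t * (f x - κ)) 0 = t * max (f x - κ) 0 := by
        rw [mul_max_of_nonneg _ _ ht0.le, mul_zero]
      rw [h8]
      simp only [smul_eq_mul]
      field_simp
      ring
    unfold SolvesEigenproblem
    filter_upwards [huf] with x hx
    rw [hx, ha.convolution_eq_of_ae hG, real_inner_smul_right, mul_assoc]
    rfl

end IsAdmissibleKernel

/-! ### Weak limits and weak differentiability of unimodal functions. -/

section WeakLimit

variable {H : Type*} [NormedAddCommGroup H] [InnerProductSpace ℝ H] [CompleteSpace H]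

/-- Bounded sequences in Hilbert spaces have weak cluster points. -/
lemma exists_weak_limit {q : ℕ → H} {C : ℝ} (hq : ∀ n, ‖q n‖ ≤ C) :
    ∃ (l : Ultrafilter ℕ) (v : H), (l : Filter ℕ) ≤ atTop ∧
      ∀ h, Tendsto (fun n => ⟪q n, h⟫) l (𝓝 ⟪v, h⟫) := by
  let φ : ℕ → WeakDual ℝ H := fun n => StrongDual.toWeakDual (InnerProductSpace.toDual ℝ H (q n))
  have hK := WeakDual.isCompact_closedBall (𝕜 := ℝ) (E := H) 0 C
  obtain ⟨x, -, hx⟩ := hK.ultrafilter_le_nhds ((hyperfilter ℕ).map φ) (by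
    rw [le_principal_iff, Ultrafilter.coe_map, mem_map]
    refine univ_mem' fun n => ?_
    simp only [Set.mem_preimage, Metric.mem_closedBall, dist_zero_right]
    change ‖InnerProductSpace.toDual ℝ H (q n)‖ ≤ C
    rw [LinearIsometryEquiv.norm_map]
    exact hq n)
  refine ⟨hyperfilter ℕ, (InnerProductSpace.toDual ℝ H).symm (WeakDual.toStrongDual x),
    Nat.hyperfilter_le_atTop, fun h => ?_⟩
  have hx' : Tendsto φ (hyperfilter ℕ) (𝓝 x) := hx
  have h1 := ((WeakDual.eval_continuous h).tendsto x).comp hx'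
  have h2 : ⟪(InnerProductSpace.toDual ℝ H).symm (WeakDual.toStrongDual x), h⟫ = x h := by
    rw [InnerProductSpace.toDual_symm_apply]
    rfl
  rw [h2]
  refine h1.congr fun n => ?_
  exact InnerProductSpace.toDual_apply_apply

end WeakLimit

lemma antitoneOn_Ici_of_Ioi {f : ℝ → ℝ} (hf : Continuous f) (h : AntitoneOn f (Set.Ioi 0)) :
    AntitoneOn f (Set.Ici 0) := by
  intro x hx y hy hxy
  rcases eq_or_lt_of_le (Set.mem_Ici.1 hx) with rfl | hx0
  · rcases eq_or_lt_of_le hxy with rfl | hy0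
    · exact le_rfl
    · refine ge_of_tendsto ((hf.tendsto 0).mono_left (nhdsWithin_le_nhds (s := Set.Ioi 0))) ?_
      filter_upwards [Ioo_mem_nhdsGT hy0] with z hz
      exact h hz.1 hy0 hz.2.le
  · exact h hx0 (hx0.trans_le hxy) hxy

lemma even_le_of_abs_le {f : ℝ → ℝ} (heven : ∀ x, f (-x) = f x)
    (hanti : AntitoneOn f (Set.Ici 0)) {x y : ℝ} (h : |x| ≤ |y|) : f y ≤ f x := by
  have habs : ∀ x, f |x| = f x := fun x => by
    rcases abs_choice x with h | h <;> rw [h]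
    exact heven x
  rw [← habs x, ← habs y]
  exact hanti (abs_nonneg x) (abs_nonneg y) h

lemma abs_sub_le_abs_add {x s : ℝ} (hx : 0 ≤ x) (hs : 0 ≤ s) : |x - s| ≤ |x + s| := by
  rw [abs_of_nonneg (add_nonneg hx hs), abs_le]
  constructor <;> linarith

/-- The integral of the central difference of a bounded even unimodal function. -/
lemma integral_abs_central_difference_le {W : ℝ → ℝ} {ξ B s : ℝ} (hW : Continuous W)
    (heven : ∀ x, W (-x) = W x) (hanti : AntitoneOn W (Set.Ici 0)) (hnn : ∀ x, 0 ≤ W x)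
    (hsupp : ∀ x, ξ ≤ |x| → W x = 0) (hB : ∀ x, W x ≤ B) (hξ : 0 ≤ ξ) (hs : 0 < s) :
    ∫ x, |W (x - s) - W (x + s)| ≤ 4 * s * B := by
  -- The central difference is odd and nonnegative for x ≥ 0, so the absolute value can be dropped
  -- on the half-line.
  have hD : ∀ x, |W (x - s) - W (x + s)| = W (|x| - s) - W (|x| + s) := by
    intro x
    have h1 : 0 ≤ W (|x| - s) - W (|x| + s) :=
      sub_nonneg.2 (even_le_of_abs_le heven hanti (abs_sub_le_abs_add (abs_nonneg x) hs.le))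
    rcases abs_cases x with ⟨h, -⟩ | ⟨h, -⟩
    · rw [h] at h1 ⊢
      exact abs_of_nonneg h1
    · have h2 : W (x - s) = W (-x + s) := by rw [← heven]; congr 1; ring
      have h3 : W (x + s) = W (-x - s) := by rw [← heven]; congr 1; ring
      rw [h] at h1 ⊢
      rw [h2, h3, abs_sub_comm]
      exact abs_of_nonneg h1
  simp_rw [hD]
  rw [integral_comp_abs (f := fun x => W (x - s) - W (x + s))]
  have h1 : ∫ x in Set.Ioi 0, (W (x - s) - W (x + s)) =
      ∫ x in (0 : ℝ)..(ξ + s), (W (x - s) - W (x + s)) := by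
    rw [intervalIntegral.integral_of_le (by linarith)]
    refine setIntegral_eq_of_subset_of_forall_sdiff_eq_zero measurableSet_Ioi
      Set.Ioc_subset_Ioi_self fun x hx => ?_
    have hx0 : 0 < x := hx.1
    have hx1 : ξ + s < x := by
      by_contra h
      exact hx.2 ⟨hx.1, not_lt.1 h⟩
    rw [hsupp, hsupp, sub_zero]
    · rw [abs_of_nonneg (by linarith)]
      linarith
    · rw [abs_of_nonneg (by linarith)]
      linarith
  have hint : ∀ p q : ℝ, IntervalIntegrable W volume p q := fun p q => hW.intervalIntegrable p q
  -- The two translated integrals cancel except on [−s, s] and on [ξ, ξ + 2s]; the second enters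
  -- with a minus sign.
  have h2 : ∫ x in (0 : ℝ)..(ξ + s), (W (x - s) - W (x + s)) ≤ ∫ x in (-s)..s, W x := by
    have i1 : Continuous fun x => W (x - s) := by fun_prop
    have i2 : Continuous fun x => W (x + s) := by fun_prop
    rw [intervalIntegral.integral_sub (i1.intervalIntegrable _ _) (i2.intervalIntegrable _ _),
      intervalIntegral.integral_comp_sub_right, intervalIntegral.integral_comp_add_right,
      intervalIntegral.integral_interval_sub_interval_comm (hint _ _) (hint _ _) (hint _ _),
      zero_sub, zero_add]
    have : 0 ≤ ∫ x in (ξ + s - s)..(ξ + s + s), W x :=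
      intervalIntegral.integral_nonneg (by linarith) fun x _ => hnn x
    linarith
  have h3 : ∫ x in (-s)..s, W x ≤ B * (2 * s) := by
    have := intervalIntegral.norm_integral_le_of_norm_le_const (a := -s) (b := s) (f := W) (C := B)
      fun x _ => by
        rw [Real.norm_of_nonneg (hnn x)]
        exact hB x
    rw [show |s - -s| = 2 * s by rw [abs_of_nonneg] <;> linarith] at this
    exact (Real.le_norm_self _).trans this
  rw [h1]
  linarith

namespace L2

lemma shift_sub_shift_neg_mem_oddCone {w : L2} {W : ℝ → ℝ} (hw : w =ᵐ[volume] W)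
    (heven : ∀ x, W (-x) = W x) (hanti : AntitoneOn W (Set.Ici 0)) {s : ℝ} (hs : 0 ≤ s) :
    shift s w - shift (-s) w ∈ oddCone := by
  have hwe : reflect w = w := by
    apply Lp.ext
    filter_upwards [coeFn_reflect w, hw, ae_neg hw] with x h1 h2 h3
    rw [h1, h2, h3, heven]
  refine ⟨by rw [map_sub, reflect_shift, reflect_shift, hwe, neg_neg, neg_sub], ?_⟩
  rw [← Lp.coeFn_nonneg]
  filter_upwards [coeFn_cut measurableSet_Ioi (shift s w - shift (-s) w),
    Lp.coeFn_sub (shift s w) (shift (-s) w), coeFn_shift s w, coeFn_shift (-s) w,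
    ae_sub hw s, ae_sub hw (-s)] with x h1 h2 h3 h4 h5 h6
  rw [h1]
  refine Set.indicator_apply_nonneg fun hx => ?_
  rw [h2, Pi.sub_apply, h3, h4, h5, h6, sub_neg_eq_add]
  exact sub_nonneg.2 (even_le_of_abs_le heven hanti
    (abs_sub_le_abs_add (le_of_lt (Set.mem_Ioi.1 hx)) hs))

lemma average_central_difference (r s : ℝ) (u : L2) :
    average r (shift s u - shift (-s) u) =
      average s (shift r u - u) - average (-s) (shift r u - u) := by
  have h : shift s u - shift (-s) u = (shift s u - u) - (shift (-s) u - u) := by abel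
  rw [h, average_sub, average_shift_sub r s, average_shift_sub r (-s)]

lemma average_smul (r t : ℝ) (g : L2) : average r (t • g) = t • average r g := by
  unfold average
  simp_rw [map_smul]
  exact intervalIntegral.integral_smul _ _

/-- A function whose central differences are of linear size possesses a weak derivative, which
belongs to the odd cone if the differences do. -/
lemma exists_weak_derivative {u : L2} {C : ℝ}
    (hbound : ∀ s : ℝ, 0 < s → ‖shift s u - shift (-s) u‖ ≤ C * s)
    (hcone : ∀ s : ℝ, 0 < s → shift s u - shift (-s) u ∈ oddCone) :
    ∃ V ∈ oddCone, ∀ r, average r V = shift r u - u := by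
  let e : ℕ → ℝ := fun n => 1 / ((n : ℝ) + 1)
  have he : ∀ n, 0 < e n := fun n => by positivity
  let q : ℕ → L2 := fun n => (2 * e n)⁻¹ • (shift (e n) u - shift (-e n) u)
  have hq : ∀ n, ‖q n‖ ≤ C / 2 := fun n => by
    simp only [q]
    rw [norm_smul, norm_inv, Real.norm_of_nonneg (by linarith [he n]), inv_mul_le_iff₀
      (by linarith [he n])]
    refine (hbound _ (he n)).trans_eq ?_
    ring
  obtain ⟨l, V, hl, hV⟩ := exists_weak_limit hq
  have hqC : ∀ n, q n ∈ oddCone := fun n =>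
    smul_mem_oddCone _ (by have := he n; positivity) _ (hcone _ (he n))
  refine ⟨V, ⟨?_, ?_⟩, fun r => ?_⟩
  · refine ext_inner_right ℝ fun h => ?_
    rw [inner_reflect, inner_neg_left]
    refine tendsto_nhds_unique (hV (reflect h)) ((hV h).neg.congr fun n => ?_)
    rw [← inner_reflect, (hqC n).1, inner_neg_left]
  · refine nonneg_of_forall_inner_nonneg fun h hh => ?_
    rw [inner_cut]
    refine ge_of_tendsto' (hV _) fun n => ?_
    rw [← inner_cut]
    exact inner_nonneg_of_nonneg (hqC n).2 hh
  · refine ext_inner_right ℝ fun h => ?_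
    rw [inner_average]
    refine tendsto_nhds_unique (hV _) ?_
    -- The quotients converge only weakly. Exchanging the two increments turns their averages into
    -- quotients `average (e n) k / e n`, symmetrised in sign, which converge strongly to k.
    have hlim : Tendsto (fun n => average r (q n)) l (𝓝 (shift r u - u)) := by
      set k := shift r u - u with hk
      have he0 : Tendsto e l (𝓝[≠] 0) :=
        tendsto_nhdsWithin_iff.2 ⟨(tendsto_one_div_add_atTop_nhds_zero_nat (𝕜 := ℝ)).mono_left hl,
          Eventually.of_forall fun n => (he n).ne'⟩
      have he1 : Tendsto (fun n => -e n) l (𝓝[≠] 0) := by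
        refine tendsto_nhdsWithin_iff.2 ⟨?_, Eventually.of_forall fun n => (neg_lt_zero.2 (he n)).ne⟩
        simpa using (tendsto_nhdsWithin_iff.1 he0).1.neg
      have h1 := ((tendsto_inv_smul_average k).comp he0).add
        ((tendsto_inv_smul_average k).comp he1)
      have h2 := h1.const_smul (2 : ℝ)⁻¹
      rw [← two_smul ℝ k, smul_smul, inv_mul_cancel₀ two_ne_zero, one_smul] at h2
      refine h2.congr fun n => ?_
      simp only [q, Function.comp_apply]
      rw [average_smul, average_central_difference, mul_inv, ← smul_smul, inv_neg, neg_smul,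
        smul_sub, sub_eq_add_neg]
    refine (hlim.inner tendsto_const_nhds).congr fun n => ?_
    rw [inner_average]

end L2

/-! ### Profiles of solutions and their uniqueness. -/

namespace IsAdmissibleKernel

open L2

variable {a : ℝ → ℝ} {c r : ℝ}

/-- The description of a solution `u` in terms of its free boundary `ξ`, the part `w` of `u` above
the threshold, and the derivative `-V`. -/
structure Profile (ha : IsAdmissibleKernel a) (c r θ : ℝ) (u : L2) where
  ξ : ℝ
  w : L2
  V : L2
  ξ_pos : 0 < ξ
  eq_solver : u = solver ha.op c r w
  rep_ξ : ha.rep c r w ξ = θ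
  mem_oddCone : V ∈ oddCone
  ne_zero : cut (Set.Ioo 0 ξ) measurableSet_Ioo V ≠ 0
  fixed : V = solver ha.op c r (oddPart (cut (Set.Ioo 0 ξ) measurableSet_Ioo V))
  w_eq : w =ᵐ[volume] primitive (oddPart (cut (Set.Ioo 0 ξ) measurableSet_Ioo V)) ξ

namespace Profile

variable {ha : IsAdmissibleKernel a} {θ : ℝ} {u : L2}

lemma truncated_eq (P : Profile ha c r θ u) :
    ha.truncated c r P.ξ (cut (Set.Ioo 0 P.ξ) measurableSet_Ioo P.V) =
      cut (Set.Ioo 0 P.ξ) measurableSet_Ioo P.V := by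
  rw [truncated_apply, cut_cut]
  simp only [Set.inter_self]
  rw [← P.fixed]

lemma cut_nonneg (P : Profile ha c r θ u) :
    0 ≤ cut (Set.Ioo 0 P.ξ) measurableSet_Ioo P.V := by
  rw [← Lp.coeFn_nonneg]
  filter_upwards [coeFn_cut (measurableSet_Ioo (a := (0 : ℝ)) (b := P.ξ)) P.V,
    ae_nonneg_of_mem_oddCone P.mem_oddCone] with x h1 h2
  rw [h1]
  exact Set.indicator_apply_nonneg fun hx => h2 hx.1

lemma V_pos (P : Profile ha c r θ u) (hc : 0 < c) (hr0 : 0 ≤ r) (hr1 : r < 1) :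
    ∀ᵐ x, 0 < x → 0 < P.V x := by
  have h := ha.coeFn_solver (c := c) hr0 hr1
    (oddPart (cut (Set.Ioo 0 P.ξ) measurableSet_Ioo P.V))
  rw [← P.fixed] at h
  filter_upwards [h] with x hx h0
  rw [hx]
  exact ha.rep_oddPart_pos hc hr0 hr1 P.cut_nonneg
    (supportedOnPos_cut _ Set.Ioo_subset_Ioi_self _) P.ne_zero h0

/-- Insert the fixed point equation of Q, move the solver to the other factor, and use the equation
of P. The factor 2 from `oddPart` of an odd function cancels. -/
lemma inner_cut_comm {u' : L2} (P : Profile ha c r θ u) (Q : Profile ha c r θ u') (hr0 : 0 ≤ r)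
    (hr1 : r < 1) :
    ⟪cut (Set.Ioo 0 P.ξ) measurableSet_Ioo P.V, Q.V⟫ =
      ⟪cut (Set.Ioo 0 Q.ξ) measurableSet_Ioo Q.V, P.V⟫ := by
  have hodd : ∀ V ∈ oddCone, oddPart V = (2 : ℝ) • V := fun V hV => by
    rw [oddPart_apply, hV.1, sub_neg_eq_add, two_smul]
  have h1 : ⟪oddPart (cut (Set.Ioo 0 P.ξ) measurableSet_Ioo P.V), Q.V⟫ =
      ⟪oddPart (cut (Set.Ioo 0 Q.ξ) measurableSet_Ioo Q.V), P.V⟫ := by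
    conv_lhs => rw [Q.fixed, ← inner_solver ha.norm_op_le hr0 hr1 ha.inner_op, ← P.fixed]
    rw [real_inner_comm]
  rw [inner_oddPart, inner_oddPart, hodd _ P.mem_oddCone, hodd _ Q.mem_oddCone,
    real_inner_smul_right, real_inner_smul_right] at h1
  exact mul_left_cancel₀ two_ne_zero h1

/-- If the edge of P came first, `inner_cut_comm` would make the integral of `P.V * Q.V` between the
edges vanish, although both factors are positive there. -/
lemma ξ_le {u' : L2} (P : Profile ha c r θ u) (Q : Profile ha c r θ u') (hc : 0 < c)
    (hr0 : 0 ≤ r) (hr1 : r < 1) : Q.ξ ≤ P.ξ := by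
  by_contra hlt
  rw [not_le] at hlt
  have hq : ∀ᵐ x, cut (Set.Ico P.ξ Q.ξ) measurableSet_Ico P.V x =
      (Set.Ico P.ξ Q.ξ).indicator P.V x := coeFn_cut _ _
  have hsplit : cut (Set.Ioo 0 Q.ξ) measurableSet_Ioo P.V =
      cut (Set.Ioo 0 P.ξ) measurableSet_Ioo P.V + cut (Set.Ico P.ξ Q.ξ) measurableSet_Ico P.V := by
    apply Lp.ext
    filter_upwards [coeFn_cut (measurableSet_Ioo (a := (0 : ℝ)) (b := Q.ξ)) P.V,
      coeFn_cut (measurableSet_Ioo (a := (0 : ℝ)) (b := P.ξ)) P.V, hq,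
      Lp.coeFn_add (cut (Set.Ioo 0 P.ξ) measurableSet_Ioo P.V)
        (cut (Set.Ico P.ξ Q.ξ) measurableSet_Ico P.V)] with x h1 h2 h3 h4
    rw [h4, Pi.add_apply, h1, h2, h3, ← Set.Ioo_union_Ico_eq_Ioo P.ξ_pos hlt.le,
      Set.indicator_union_of_disjoint]
    rw [Set.disjoint_left]
    exact fun y hy hy' => not_lt.2 hy'.1 hy.2
  have hzero : ⟪cut (Set.Ico P.ξ Q.ξ) measurableSet_Ico P.V, Q.V⟫ = 0 := by
    have h1 := P.inner_cut_comm Q hr0 hr1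
    have h2 : ⟪cut (Set.Ioo 0 Q.ξ) measurableSet_Ioo Q.V, P.V⟫ =
        ⟪cut (Set.Ioo 0 Q.ξ) measurableSet_Ioo P.V, Q.V⟫ := by
      rw [inner_cut, real_inner_comm]
    rw [h2, hsplit, inner_add_left] at h1
    linarith
  have h0 : cut (Set.Ico P.ξ Q.ξ) measurableSet_Ico P.V = 0 := by
    refine eq_zero_of_inner_eq_zero (E := Set.Ioi 0) (Q.V_pos hc hr0 hr1) ?_ ?_ hzero
    · rw [← Lp.coeFn_nonneg]
      filter_upwards [hq, P.V_pos hc hr0 hr1] with x h1 h2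
      rw [h1]
      exact Set.indicator_apply_nonneg fun hx => (h2 (P.ξ_pos.trans_le hx.1)).le
    · filter_upwards [hq] with x h1 h2
      rw [h1, Set.indicator_of_notMem]
      exact fun hx => h2 (P.ξ_pos.trans_le hx.1)
  have hae : ∀ᵐ x, x ∉ Set.Ico P.ξ Q.ξ := by
    filter_upwards [hq, P.V_pos hc hr0 hr1, Lp.coeFn_zero ℝ 2 (volume : Measure ℝ)]
      with x h1 h2 h3 hx
    rw [h0, h3, Set.indicator_of_mem hx] at h1
    exact (h2 (P.ξ_pos.trans_le hx.1)).ne h1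
  rw [ae_iff] at hae
  simp only [not_not] at hae
  have : volume (Set.Ico P.ξ Q.ξ) = 0 := hae
  rw [Real.volume_Ico, ENNReal.ofReal_eq_zero] at this
  linarith

/-- With a common edge both derivatives are fixed points of one irreducible operator, hence
proportional. The shared value θ at the edge makes the factor 1. -/
lemma eq {u' : L2} (P : Profile ha c r θ u) (Q : Profile ha c r θ u') (hθ : θ ≠ 0) (hc : 0 < c)
    (hr0 : 0 ≤ r) (hr1 : r < 1) : u = u' := by
  have hξ : P.ξ = Q.ξ := le_antisymm (Q.ξ_le P hc hr0 hr1) (P.ξ_le Q hc hr0 hr1)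
  have hTP := P.truncated_eq
  have hPw := P.w_eq
  have hPξ := P.rep_ξ
  rw [hξ] at hTP hPw hPξ
  obtain ⟨t, ht⟩ := exists_eq_smul_of_fixed (ha.inner_truncated hr0 hr1 Q.ξ)
    (ha.truncated_nonneg hc.le hr0 hr1 Q.ξ) (ha.truncated_support Q.ξ)
    (ha.truncated_strict hc hr0 hr1 Q.ξ) Q.cut_nonneg Q.ne_zero Q.truncated_eq hTP
  have hw : P.w = t • Q.w := by
    apply Lp.ext
    have h1 := Lp.coeFn_smul t (oddPart (cut (Set.Ioo 0 Q.ξ) measurableSet_Ioo Q.V))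
    filter_upwards [hPw, Q.w_eq, Lp.coeFn_smul t Q.w] with x h2 h3 h4
    rw [h2, h4, Pi.smul_apply, h3, ht, map_smul, primitive, primitive, smul_eq_mul,
      ← intervalIntegral.integral_const_mul]
    exact intervalIntegral.integral_congr_ae (h1.mono fun y hy _ => hy)
  have hrep : ha.rep c r P.w Q.ξ = t * ha.rep c r Q.w Q.ξ := by
    rw [hw, rep, rep, map_smul, smul_comm c, smul_comm r, ← smul_add, real_inner_smul_right]
  rw [hPξ, Q.rep_ξ] at hrep
  have ht1 : t = 1 := by
    have : (t - 1) * θ = 0 := by linarith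
    exact sub_eq_zero.1 ((mul_eq_zero.1 this).resolve_right hθ)
  rw [P.eq_solver, Q.eq_solver, hw, ht1, one_smul]

end Profile

lemma not_ae_le_of_pos {u : L2} {ε : ℝ} (hε : 0 < ε) : ¬ ∀ᵐ x, 0 < x → ε ≤ u x := by
  intro h
  have hn : ∀ n : ℕ, ε * √n ≤ ‖u‖ := by
    intro n
    have h1 : ‖ε • box n‖ ≤ ‖u‖ := by
      apply Lp.norm_le_norm_of_ae_le
      filter_upwards [Lp.coeFn_smul ε (box n), coeFn_box n, h] with x h1 h2 h3
      rw [h1, Pi.smul_apply, h2]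
      by_cases hx : x ∈ Set.Ioo 0 (n : ℝ)
      · rw [Set.indicator_of_mem hx, smul_eq_mul, mul_one, Real.norm_of_nonneg hε.le]
        exact (h3 hx.1).trans (Real.le_norm_self _)
      · simp [hx]
    rwa [norm_smul, norm_box (Nat.cast_nonneg n), Real.norm_of_nonneg hε.le] at h1
  obtain ⟨n, hn'⟩ := exists_nat_gt ((‖u‖ / ε) ^ 2)
  have h2 : ‖u‖ / ε < √n := Real.lt_sqrt_of_sq_lt hn'
  rw [div_lt_iff₀' hε] at h2
  exact absurd (hn n) (not_le.2 h2)

/-- A violation of monotonicity is an open condition on pairs for continuous f, so it would meet the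
dense set of good pairs. -/
lemma antitoneOn_of_mem_unimodalCone {u : L2} (hu : (u : ℝ → ℝ) ∈ unimodalCone) {f : ℝ → ℝ}
    (hf : Continuous f) (huf : u =ᵐ[volume] f) : AntitoneOn f (Set.Ici 0) := by
  refine antitoneOn_Ici_of_Ioi hf fun x hx y hy hxy => ?_
  by_contra hlt
  rw [not_le] at hlt
  have hne : x ≠ y := by rintro rfl; exact lt_irrefl _ hlt
  have hU : IsOpen ({p : ℝ × ℝ | 0 < p.1} ∩ {p : ℝ × ℝ | p.1 < p.2} ∩
      {p : ℝ × ℝ | f p.1 < f p.2}) :=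
    ((isOpen_lt continuous_const continuous_fst).inter
      (isOpen_lt continuous_fst continuous_snd)).inter
        (isOpen_lt (hf.comp continuous_fst) (hf.comp continuous_snd))
  have hae : ∀ᵐ p : ℝ × ℝ, 0 < p.1 → p.1 < p.2 → f p.2 ≤ f p.1 := by
    have h1 : ∀ᵐ p : ℝ × ℝ, u p.1 = f p.1 := Measure.quasiMeasurePreserving_fst.ae huf
    have h2 : ∀ᵐ p : ℝ × ℝ, u p.2 = f p.2 := Measure.quasiMeasurePreserving_snd.ae huf
    filter_upwards [h1, h2, hu.2.2] with p h1 h2 h3 h4 h5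
    rw [← h1, ← h2]
    exact (h3 h4 h5).1
  obtain ⟨p, ⟨⟨h1, h2⟩, h3⟩, h4⟩ := (Measure.dense_of_ae hae).inter_open_nonempty _ hU
    ⟨(x, y), ⟨hx, lt_of_le_of_ne hxy hne⟩, hlt⟩
  have h3 : f p.1 < f p.2 := h3
  exact absurd (h4 h1 h2) (not_le.2 h3)

/-- A continuous decreasing function attains each level strictly between two of its values. -/
lemma exists_edge {f : ℝ → ℝ} {θ : ℝ} (hf : Continuous f) (hanti : AntitoneOn f (Set.Ici 0))
    (h1 : ∃ x, 0 < x ∧ θ < f x) (h2 : ∃ x, 0 < x ∧ f x < θ) : ∃ ξ, 0 < ξ ∧ f ξ = θ := by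
  obtain ⟨x, hx, hx'⟩ := h1
  obtain ⟨y, hy, hy'⟩ := h2
  have hxy : x ≤ y := by
    by_contra h
    exact absurd (hanti hy.le hx.le (not_le.1 h).le) (not_le.2 (hy'.trans hx'))
  obtain ⟨ξ, hξ, hξ'⟩ := intermediate_value_Icc' hxy hf.continuousOn ⟨hy'.le, hx'.le⟩
  exact ⟨ξ, hx.trans_le hξ.1, hξ'⟩

end IsAdmissibleKernel

/-! ### Every solution has a profile. -/

namespace IsAdmissibleKernel

open L2

variable {a : ℝ → ℝ}

/-- The point is to differentiate u, known only to be continuous. The differences of w are O(s) in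
L¹ by unimodality, and the solver converts this into an L² bound on those of u. -/
lemma exists_profile_of_rep (ha : IsAdmissibleKernel a) {c r θ : ℝ} (hc : 0 < c) (hr0 : 0 ≤ r)
    (hr1 : r < 1) (hθ : 0 < θ) {u w : L2} (huw : u = solver ha.op c r w) (hu0 : u ≠ 0)
    (hcone : (u : ℝ → ℝ) ∈ unimodalCone)
    (hw : w =ᵐ[volume] fun x => max (u x - θ) 0) : Nonempty (ha.Profile c r θ u) := by
  set f := ha.rep c r w with hf
  have hfc : Continuous f := ha.continuous_rep w
  have huf : u =ᵐ[volume] f := by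
    rw [huw]
    exact ha.coeFn_solver hr0 hr1 w
  have hw0 : w ≠ 0 := by
    rintro rfl
    exact hu0 (by rw [huw, map_zero])
  have hanti : AntitoneOn f (Set.Ici 0) := antitoneOn_of_mem_unimodalCone hcone hfc huf
  have hweven : reflect w = w := by
    apply Lp.ext
    filter_upwards [coeFn_reflect w, hw, ae_neg hw, hcone.2.1] with x h1 h2 h3 h4
    rw [h1, h2, h3, ← h4]
  have heven : ∀ x, f (-x) = f x := ha.rep_neg hr0 hr1 hweven
  set W : ℝ → ℝ := fun x => max (f x - θ) 0 with hW
  have hwW : w =ᵐ[volume] W := by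
    filter_upwards [hw, huf] with x h1 h2
    rw [h1, h2]
  have hWc : Continuous W := (hfc.sub continuous_const).max continuous_const
  have hWeven : ∀ x, W (-x) = W x := fun x => by simp only [hW, heven]
  have hWanti : AntitoneOn W (Set.Ici 0) := fun x hx y hy hxy =>
    max_le_max (sub_le_sub_right (hanti hx hy hxy) _) le_rfl
  have hWnn : ∀ x, 0 ≤ W x := fun x => le_max_right _ _
  have hfabs : ∀ x, f |x| = f x := fun x => by
    rcases abs_choice x with h | h <;> rw [h]
    exact heven x
  -- With no value above θ, w would vanish; with none below, u would not be square integrable.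
  obtain ⟨ξ, hξ, hfξ⟩ : ∃ ξ, 0 < ξ ∧ f ξ = θ := by
    refine exists_edge hfc hanti ?_ ?_
    · by_contra! h
      refine hw0 (Lp.ext ?_)
      filter_upwards [hwW, ae_ne 0, Lp.coeFn_zero ℝ 2 (volume : Measure ℝ)] with x h1 h2 h3
      rw [h1, h3, hW]
      refine max_eq_right (sub_nonpos.2 ?_)
      rw [← hfabs]
      exact h _ (abs_pos.2 h2)
    · by_contra! h
      refine not_ae_le_of_pos (u := u) hθ ?_
      filter_upwards [huf] with x h1 h2
      rw [h1]
      exact h x h2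
  have hWsupp : ∀ x, ξ ≤ |x| → W x = 0 := fun x hx => by
    refine max_eq_right (sub_nonpos.2 ?_)
    rw [← hfabs, ← hfξ]
    exact hanti hξ.le (abs_nonneg x) hx
  have hWin : ∀ x, |x| ≤ ξ → W x = f |x| - f ξ := fun x hx => by
    rw [hfξ, hfabs]
    refine max_eq_left (sub_nonneg.2 ?_)
    rw [← hfabs, ← hfξ]
    exact hanti (abs_nonneg x) hξ.le hx
  set M := ‖ha.vec‖ * (c + r * ‖solver ha.op c r‖) with hM
  have hM0 : 0 ≤ M := by positivity
  have hWB : ∀ x, W x ≤ M * ‖w‖ := fun x => by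
    have h1 : f x ≤ M * ‖w‖ := (le_abs_self _).trans (ha.abs_rep_le hc.le hr0 w x)
    exact max_le (by linarith) (by positivity)
  have hWint : Integrable W := by
    refine hWc.integrable_of_hasCompactSupport
      (HasCompactSupport.intro (isCompact_Icc (a := -ξ) (b := ξ)) fun x hx => hWsupp x ?_)
    by_contra h
    rw [not_le, abs_lt] at h
    exact hx ⟨h.1.le, h.2.le⟩
  have hdiff : ∀ s : ℝ, shift s u - shift (-s) u =
      solver ha.op c r (shift s w - shift (-s) w) := fun s => by
    rw [huw, ha.shift_solver hr0 hr1, ha.shift_solver hr0 hr1, map_sub]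
  have hbound : ∀ s : ℝ, 0 < s →
      ‖shift s u - shift (-s) u‖ ≤ (M * (4 * (M * ‖w‖))) * s := by
    intro s hs
    have hD : (shift s w - shift (-s) w : L2) =ᵐ[volume] fun x => W (x - s) - W (x + s) := by
      filter_upwards [Lp.coeFn_sub (shift s w) (shift (-s) w), coeFn_shift s w,
        coeFn_shift (-s) w, ae_sub hwW s, ae_sub hwW (-s)] with x h1 h2 h3 h4 h5
      rw [h1, Pi.sub_apply, h2, h3, h4, h5, sub_neg_eq_add]
    have hDint : Integrable (shift s w - shift (-s) w : L2) :=
      ((hWint.comp_sub_right s).sub (hWint.comp_add_right s)).congr hD.symm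
    rw [hdiff]
    refine (ha.norm_solver_le_integral hc.le hr0 hr1 hDint).trans ?_
    have h1 : ∫ x, |(shift s w - shift (-s) w : L2) x| = ∫ x, |W (x - s) - W (x + s)| :=
      integral_congr_ae (hD.mono fun x hx => congrArg abs hx)
    rw [h1]
    have h2 := integral_abs_central_difference_le hWc hWeven hWanti hWnn hWsupp hWB hξ.le hs
    calc M * ∫ x, |W (x - s) - W (x + s)| ≤ M * (4 * s * (M * ‖w‖)) := by gcongr
      _ = _ := by ring
  obtain ⟨V, hVC, hV⟩ := exists_weak_derivative hbound fun s hs => by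
    rw [hdiff]
    exact ha.solver_mem_oddCone hc.le hr0 hr1
      (shift_sub_shift_neg_mem_oddCone hwW hWeven hWanti hs.le)
  have hfV : ∀ x y, f x - f y = ∫ z in x..y, V z :=
    sub_eq_integral_of_average huf hfc fun s _ => (hV s).symm
  set p := cut (Set.Ioo 0 ξ) measurableSet_Ioo V with hp
  have hps : SupportedOnPos p := supportedOnPos_cut _ Set.Ioo_subset_Ioi_self V
  have hgodd : ∀ᵐ x, oddPart p (-x) = -oddPart p x := by
    filter_upwards [coeFn_oddPart p, ae_neg (coeFn_oddPart p)] with x h1 h2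
    rw [h1, h2, neg_neg, neg_sub]
  have hgV : ∀ᵐ x, 0 < x → oddPart p x = (Set.Ioo 0 ξ).indicator V x := by
    filter_upwards [coeFn_oddPart_of_supportedOnPos hps,
      coeFn_cut (measurableSet_Ioo (a := (0 : ℝ)) (b := ξ)) V] with x h1 h2 h3
    rw [h1 h3, hp, h2]
  have hWprim : ∀ x, W x = primitive (oddPart p) ξ x := by
    intro x
    rw [← primitive_abs hgodd, primitive]
    rcases le_total |x| ξ with h | h
    · rw [hWin x h, hfV]
      refine intervalIntegral.integral_congr_ae ?_
      filter_upwards [hgV, ae_ne ξ] with z h2 h3 h4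
      rw [Set.uIoc_of_le h] at h4
      have h5 : 0 < z := (abs_nonneg x).trans_lt h4.1
      rw [h2 h5, Set.indicator_of_mem (show z ∈ Set.Ioo 0 ξ from ⟨h5, lt_of_le_of_ne h4.2 h3⟩)]
    · rw [hWsupp x h, intervalIntegral.integral_symm, eq_comm, neg_eq_zero]
      refine intervalIntegral.integral_zero_ae ?_
      filter_upwards [hgV] with z h2 h4
      rw [Set.uIoc_of_le h] at h4
      rw [h2 (hξ.trans h4.1), Set.indicator_of_notMem fun h5 => not_lt.2 h4.1.le h5.2]
  have hwprim : w =ᵐ[volume] primitive (oddPart p) ξ := by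
    filter_upwards [hwW] with x hx
    rw [hx, hWprim]
  -- Both sides have the increments of u as averages, because the solver commutes with translations.
  have hfixed : V = solver ha.op c r (oddPart p) := by
    rw [← sub_eq_zero]
    refine eq_zero_of_average_eq_zero fun s hs => ?_
    rw [average_sub, hV, huw, ha.shift_solver_sub hr0 hr1
      (shift_sub_eq_average hwprim (primitive_sub _ ξ) hs), sub_self]
  have hp0 : p ≠ 0 := by
    intro h
    refine hw0 (Lp.ext ?_)
    filter_upwards [hwW, Lp.coeFn_zero ℝ 2 (volume : Measure ℝ)] with x h1 h2
    rw [h1, h2, hWprim, primitive, h, map_zero]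
    exact intervalIntegral.integral_zero_ae ((Lp.coeFn_zero ℝ 2 volume).mono fun y hy _ => hy)
  exact ⟨⟨ξ, w, V, hξ, huw, hfξ, hVC, hp0, hfixed, hwprim⟩⟩

lemma exists_profile (ha : IsAdmissibleKernel a) {ζ θ η σ : ℝ} (hζ : 0 ≤ ζ) (hθ : 0 < θ)
    (hη : 0 < η) (hσ : ζ < σ) {u : L2} (hu0 : u ≠ 0) (hcone : (u : ℝ → ℝ) ∈ unimodalCone)
    (hu : SolvesEigenproblem a ζ θ η σ u) : Nonempty (ha.Profile (η / σ) (ζ / σ) θ u) := by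
  have hσ0 : 0 < σ := hζ.trans_lt hσ
  have hr0 : 0 ≤ ζ / σ := div_nonneg hζ hσ0.le
  have hr1 : ζ / σ < 1 := (div_lt_one hσ0).2 hσ
  have hmem : MemLp (fun x => max (u x - θ) 0) 2 := by
    refine (Lp.memLp u).mono
      (((Lp.aestronglyMeasurable u).sub aestronglyMeasurable_const).sup
        aestronglyMeasurable_const) (Eventually.of_forall fun x => ?_)
    rw [Real.norm_of_nonneg (le_max_right _ _)]
    exact max_le (by linarith [Real.le_norm_self (u x)]) (norm_nonneg _)
  set w : L2 := hmem.toLp _ with hw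
  have hww : w =ᵐ[volume] fun x => max (u x - θ) 0 := hmem.coeFn_toLp
  have hG : (fun y => bilinear ζ θ η (u y)) =ᵐ[volume]
      (σ • ((η / σ) • w + (ζ / σ) • u) : L2) := by
    filter_upwards [hww, Lp.coeFn_smul σ ((η / σ) • w + (ζ / σ) • u),
      Lp.coeFn_add ((η / σ) • w) ((ζ / σ) • u), Lp.coeFn_smul (η / σ) w,
      Lp.coeFn_smul (ζ / σ) u] with x h1 h2 h3 h4 h5
    rw [h2, Pi.smul_apply, h3, Pi.add_apply, h4, h5, Pi.smul_apply, Pi.smul_apply, h1,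
      bilinear_eq]
    simp only [smul_eq_mul]
    field_simp
    ring
  have huA : u = ha.op ((η / σ) • w + (ζ / σ) • u) := by
    apply Lp.ext
    filter_upwards [hu, ha.coeFn_op ((η / σ) • w + (ζ / σ) • u)] with x h1 h2
    rw [ha.convolution_eq_of_ae hG, real_inner_smul_right] at h1
    rw [h2]
    exact mul_left_cancel₀ hσ0.ne' h1
  exact ha.exists_profile_of_rep (div_pos hη hσ0) hr0 hr1 hθ
    (eq_solver ha.norm_op_le hr0 hr1 huA) hu0 hcone hww

end IsAdmissibleKernel

theorem proposition3p2 (ζ θ η : ℝ) (hζ : 0 ≤ ζ) (hθ : 0 < θ) (hη : 0 < η)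
    (a : ℝ → ℝ) (ha : IsAdmissibleKernel a)
    (σ : ℝ) (hσ : σ ∈ Set.Ioo ζ (ζ + η)) :
    ∃! u : Lp ℝ 2 (volume : Measure ℝ),
      u ≠ 0 ∧ (u : ℝ → ℝ) ∈ unimodalCone ∧ SolvesEigenproblem a ζ θ η σ u := by
  have hσ0 : 0 < σ := hζ.trans_lt hσ.1
  obtain ⟨u, hu⟩ := ha.exists_solution hζ hθ hη hσ
  refine ⟨u, hu, fun v hv => ?_⟩
  obtain ⟨P⟩ := ha.exists_profile hζ hθ hη hσ.1 hu.1 hu.2.1 hu.2.2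
  obtain ⟨Q⟩ := ha.exists_profile hζ hθ hη hσ.1 hv.1 hv.2.1 hv.2.2
  exact Q.eq P hθ.ne' (div_pos hη hσ0) (div_nonneg hζ hσ0.le) ((div_lt_one hσ0).2 hσ.1)
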